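/- **Setting.** A vector $\mathbf{x}\in\mathbb{R}_+^n$, initially $0$, is subject to a fixed stream of updates $(v_i,\Delta_i)\in[n]\times(0,\infty)$, the $i$-th of which sets $\mathbf{x}(v_i)\gets\mathbf{x}(v_i)+\Delta_i$. Let $\mathcal{G}$ be the set of functions $G:\mathbb{R}_+\to\mathbb{R}_+$ of the form $$G(z)=c\,\mathbf 1[z>0]+\gamma_0 z+\int_{(0,\infty)}(1-e^{-rz})\,\nu(dr),\qquad c,\gamma_0\ge 0,\quad \int_{(0,\infty)}\min\{r,1\}\,\nu(dr)<\infty,$$ with $\nu$ a non-negative measure, and put $G(\mathbf{x})=\sum_{v\in[n]}G(\mathbf{x}(v))$. A non-negative Lévy process $(X_t)_{t\ge0}$, with values in $[0,\infty]$, corresponds to $G$ if $\mathbb{E}e^{-zX_t}=e^{-tG(z)}$ for all $t,z\ge 0$; its level function is $\ell_G(a,b)=\inf\{t\ge 0 : \mathbb{P}(X_t\ge a)\ge b\}$. (The increments of a $[0,\infty]$-valued process are understood additively: for durations $s_1,\dots,s_k\ge0$, the vector $(X_{s_1},X_{s_1+s_2},\dots,X_{s_1+\cdots+s_k})$ is distributed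 as the partial sums $(D_1,D_1+D_2,\dots,D_1+\cdots+D_k)$ of independent $D_i\sim X_{s_i}$.) *ParetoSampler* uses a hash function $H:[n]\to[0,1]$ with independent uniform values and, for the $i$-th update, a fresh $Y_i\sim\mathrm{Exp}(1)$, all mutually independent. Its state is a finite set $S$ of tuples in $\mathbb{R}_+\times[0,1]\times[n]$, initially empty; the $i$-th update sets $S\gets\mathrm{Pareto}(S\cup\{(Y_i/\Delta_i,H(v_i),v_i)\})$. Here $\mathrm{Pareto}(L)$ consists of the tuples $(a,b,v)\in L$ such that every point $(a',b')\neq(a,b)$ occurring as the first two coordinates of a tuple of $L$ with $a'\le a$ satisfies $b<b'$. A word stores a real number or an index, so $S$ occupies $3|S|$ words. The query $\mathsf{Sample}(G)$ returns the index $v_*$ of a tuple $(a,b,v_*)\in S$ that minimizes $\ell_G(a,b)$. **Theorem (ParetoSampler).** 1. *(Space.)* For all $A,k,d\in\mathbb{N}$ there is a constant $C$ such that for every $n$, every stream and every $m\le A n^k$, with probability at least $1-n^{-d}$ the state occupies at most $C\log n$ words at all times during the first $m$ updates. 2. *(Expected size.)* At any time, $\mathbb{E}|S|=\sum_{j=1}^{s}1/j$,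 where $s=|\{v\in[n]:\mathbf{x}(v)>0\}|$; in particular $\mathbb{E}|S|$ is the harmonic number $H_n=\sum_{j=1}^n 1/j$ as soon as every coordinate has been updated, and $\mathbb{E}|S|\le H_n$ always. 3. *(Sampling.)* Every $G\in\mathcal{G}$ has a corresponding non-negative Lévy process. At any time, for every $G\in\mathcal{G}$ with $G(\mathbf{x})>0$ and the level function $\ell_G$ of any Lévy process corresponding to $G$, the query $\mathsf{Sample}(G)$ returns $v_*$ with $\mathbb{P}(v_*=v)=G(\mathbf{x}(v))/G(\mathbf{x})$ for every $v\in[n]$. -/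

import Mathlib

open MeasureTheory ProbabilityTheory Filter Topology
open scoped NNReal ENNReal

noncomputable section

namespace ParetoSampling

/-! ### The class of functions `G` -/

/-- The functions `G : ℝ₊ → ℝ₊` of the form
`G z = c 𝟙{z > 0} + γ z + ∫_{(0,∞)} (1 - e^{-rz}) ν(dr)` with `c, γ ≥ 0` and `ν` a non-negative
measure on `(0,∞)` with `∫ min(r,1) ν(dr) < ∞` (the last condition makes the integral converge). -/
def classG : Set (ℝ≥0 → ℝ≥0) :=
  {G | ∃ (c γ : ℝ≥0) (ν : Measure ℝ),
    ∫⁻ r in Set.Ioi (0 : ℝ), ENNReal.ofReal (min r 1) ∂ν < ∞ ∧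
    ∀ z : ℝ≥0, (G z : ℝ) =
      c * (if 0 < z then 1 else 0) + γ * z
        + ∫ r in Set.Ioi (0 : ℝ), (1 - Real.exp (-(r * z))) ∂ν}

/-- The `G`-moment `G(x) = ∑ v, G (x v)` of a vector. -/
def moment {n : ℕ} (G : ℝ≥0 → ℝ≥0) (x : Fin n → ℝ≥0) : ℝ≥0 := ∑ v, G (x v)

/-! ### Non-negative Lévy processes and level functions -/

/-- Non-negative Lévy processes, allowed to take the value `∞`.

Since `X_{t+s} - X_t` has no meaning on `{X_t = ∞}`, stationarity and independence of the
increments are expressed by addition: for all durations `s 0, s 1, …, s (k-1)`, the values of the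
process at the times `s 0, s 0 + s 1, …` are jointly distributed as the partial sums
`D 0, D 0 + D 1, …` of independent variables with `D i` distributed as `X (s i)`. For a process
with finite values this says exactly that the increments over consecutive intervals are
independent and that an increment over an interval of length `s` is distributed as `X s`. -/
structure IsNonnegLevy {Ω : Type*} [MeasurableSpace Ω] (P : Measure Ω)
    (X : ℝ≥0 → Ω → ℝ≥0∞) : Prop where
  isProbabilityMeasure : IsProbabilityMeasure P
  measurable : ∀ t, Measurable (X t)
  increments : ∀ (k : ℕ) (s : Fin k → ℝ≥0),
    P.map (fun ω (i : Fin k) => X (∑ j ∈ Finset.Iic i, s j) ω) =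
      (Measure.pi fun i => P.map (X (s i))).map
        (fun (d : Fin k → ℝ≥0∞) (i : Fin k) => ∑ j ∈ Finset.Iic i, d j)
  zero : ∀ᵐ ω ∂P, X 0 ω = 0
  stochastic_continuity : ∀ ε : ℝ≥0, 0 < ε →
    Tendsto (fun t : ℝ≥0 => P {ω | (ε : ℝ≥0∞) < X t ω}) (𝓝[>] 0) (𝓝 0)

/-- `X` is a non-negative Lévy process corresponding to `G`:
`E e^{-z X_t} = e^{-t G(z)}` for all `t, z ≥ 0`
(with `e^{-∞} = 0`, and `0 * ∞ = 0` in the exponent when `z = 0`). -/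
structure IsLevyOf {Ω : Type*} [MeasurableSpace Ω] (G : ℝ≥0 → ℝ≥0) (P : Measure Ω)
    (X : ℝ≥0 → Ω → ℝ≥0∞) : Prop where
  isNonnegLevy : IsNonnegLevy P X
  laplace : ∀ t z : ℝ≥0,
    ∫⁻ ω, EReal.exp (-(((z : ℝ≥0∞) * X t ω : ℝ≥0∞) : EReal)) ∂P =
      ENNReal.ofReal (Real.exp (-((t : ℝ) * G z)))

/-- The Lévy-induced level function `ℓ(a,b) = inf {t ≥ 0 | P(X_t ≥ a) ≥ b}`
(the infimum of the empty set is `∞`). -/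
def levelFunction {Ω : Type*} [MeasurableSpace Ω] (P : Measure Ω) (X : ℝ≥0 → Ω → ℝ≥0∞)
    (a b : ℝ) : ℝ≥0∞ :=
  ⨅ (t : ℝ≥0) (_ : ENNReal.ofReal b ≤ P {ω | ENNReal.ofReal a ≤ X t ω}), (t : ℝ≥0∞)

/-! ### The streaming algorithm -/

open Classical in
/-- The minimum Pareto frontier of a finite set of tuples with respect to the first two
coordinates: the tuples `(a, b, v)` such that every point `(a', b') ≠ (a, b)` of the set with
`a' ≤ a` has `b < b'`. -/
def pareto {n : ℕ} (L : Finset (ℝ × ℝ × Fin n)) : Finset (ℝ × ℝ × Fin n) :=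
  L.filter fun p => ∀ q ∈ L, (q.1, q.2.1) ≠ (p.1, p.2.1) → q.1 ≤ p.1 → p.2.1 < q.2.1

open Classical in
/-- The state after the first `t` updates `(v 0, Δ 0), …, (v (t-1), Δ (t-1))`, where `y i` is the
exponential variable generated in the `i`-th update and `h` is the hash function. -/
def state {n : ℕ} (v : ℕ → Fin n) (Δ : ℕ → ℝ≥0) (y : ℕ → ℝ) (h : Fin n → ℝ) :
    ℕ → Finset (ℝ × ℝ × Fin n)
  | 0 => ∅
  | t + 1 => pareto (state v Δ y h t ∪ {(y t / (Δ t : ℝ), h (v t), v t)})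

/-- The number of words in which a state is stored: a word holds an index or a
real number, so that every tuple takes three words. -/
def words {n : ℕ} (S : Finset (ℝ × ℝ × Fin n)) : ℕ := 3 * S.card

open Classical in
/-- The query: the index of a tuple of `S` that minimizes `ℓ` (failure, `none`, if `S` is empty). -/
def sample {n : ℕ} (l : ℝ → ℝ → ℝ≥0∞) (S : Finset (ℝ × ℝ × Fin n)) : Option (Fin n) :=
  if hS : S.Nonempty then
    some (Classical.choose (S.exists_min_image (fun p => l p.1 p.2.1) hS)).2.2
  else none

/-- The vector `x` after the first `t` updates. -/
def vec {n : ℕ} (v : ℕ → Fin n) (Δ : ℕ → ℝ≥0) (t : ℕ) (u : Fin n) : ℝ≥0 :=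
  ∑ i ∈ Finset.range t, if v i = u then Δ i else 0

/-- The randomness of the algorithm: fresh `Y i ∼ Exp(1)` for every update, and a uniformly random
hash function `H : [n] → [0,1]`, all mutually independent. -/
structure IsRandomness {Ω : Type*} [MeasurableSpace Ω] {n : ℕ} (P : Measure Ω)
    (Y : ℕ → Ω → ℝ) (H : Fin n → Ω → ℝ) : Prop where
  isProbabilityMeasure : IsProbabilityMeasure P
  measurable_Y : ∀ i, Measurable (Y i)
  measurable_H : ∀ u, Measurable (H u)
  law_Y : ∀ i, P.map (Y i) = expMeasure 1
  law_H : ∀ u, P.map (H u) = volume.restrict (Set.Icc (0 : ℝ) 1)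
  indep : iIndepFun (Sum.elim Y H) P

end ParetoSampling

end

/-! A discarded tuple is dominated by a retained one, so the state is always the set of tuples
minimal for the product order among all tuples generated so far (`state_eq_pareto_tuples`). All
tuples of a coordinate `u` share the hash `h u`, so only the one with the smallest value `M u`
matters. Unless two values tie, which has probability zero, the frontier therefore corresponds to
the coordinates whose hash is a strict record when coordinates are listed by increasing `M`
(`card_pareto_tuples`).

Size: the vector `M` is independent of the hashes, so the frontier has the law of the number of
records of `s` independent uniform variables. The element listed `j`-th is a record with probability
`1/j`, which gives the harmonic number (`lintegral_card_records`). Moreover the mean of `2 ^ |S|` is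
exactly `s + 1` (`lintegral_two_pow_card_records`), so Markov's inequality and a union bound over
the times give the space bound.

Sampling: `M u` is exponential of rate `x u`. For an independent uniform `U`, the event `P(X_s ≥ M)
< U` has probability `P(X_s < M) = E e^{-x X_s} = e^{-s G(x)}`. Hence the level of `u` is
exponential of rate `G (x u)` (`IsLevyOf.measure_lt_levelFunction`). The levels are independent, and
the smallest of independent exponential variables falls on `u` with probability proportional to its
rate (`measure_forall_lt_eq_div`). Monotonicity of the level function ensures that the frontier
contains a minimizer.

Existence: the process is a drift plus the jumps of a Poisson random measure on sizes times time,
with a jump to `∞` at rate `c`. Its Laplace functional (`exists_lintegral_expNeg_poissonSum`) gives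
the joint Laplace transform of increments, and uniqueness of Laplace transforms on `[0,∞]^k`
(`ext_of_lintegral_expNeg`) gives the Lévy property. -/

noncomputable section

namespace ParetoSampling

/-! ### The frontier as a set of minimal elements -/

/-- The point of the plane occupied by a tuple. -/
def point {n : ℕ} (p : ℝ × ℝ × Fin n) : ℝ × ℝ := (p.1, p.2.1)

/-- By contraposition: a distinct point with `a' ≤ a` violates `b < b'` exactly when it lies below
in the product order. Tuples sharing a point do not exclude each other. -/
lemma mem_pareto {n : ℕ} {L : Finset (ℝ × ℝ × Fin n)} {p : ℝ × ℝ × Fin n} :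
    p ∈ pareto L ↔ p ∈ L ∧ ∀ q ∈ L, point q ≤ point p → point q = point p := by
  classical
  simp only [pareto, Finset.mem_filter, point]
  refine and_congr_right fun _ => forall₂_congr fun q _ => ?_
  constructor
  · intro h hle
    by_contra hne
    exact absurd (h hne hle.1) (not_lt.2 hle.2)
  · intro h hne h1
    by_contra h2
    exact hne (h ⟨h1, not_lt.1 h2⟩)

lemma pareto_subset {n : ℕ} (L : Finset (ℝ × ℝ × Fin n)) : pareto L ⊆ L :=
  fun _ hp => (mem_pareto.1 hp).1

lemma exists_mem_pareto_le {n : ℕ} {L : Finset (ℝ × ℝ × Fin n)} {p : ℝ × ℝ × Fin n}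
    (hp : p ∈ L) : ∃ q ∈ pareto L, point q ≤ point p := by
  classical
  obtain ⟨x, hx, hmin⟩ := (L.image point).exists_le_minimal (Finset.mem_image_of_mem point hp)
  obtain ⟨q, hq, rfl⟩ := Finset.mem_image.1 hmin.1
  exact ⟨q, mem_pareto.2 ⟨hq, fun r hr hle =>
    le_antisymm hle (hmin.2 (Finset.mem_image_of_mem point hr) hle)⟩, hx⟩

-- Every tuple dropped from `L` lies above a kept one, so dropping it early cannot change which
-- tuples are minimal later.
open Classical in
lemma pareto_pareto_union {n : ℕ} (L M : Finset (ℝ × ℝ × Fin n)) :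
    pareto (pareto L ∪ M) = pareto (L ∪ M) := by
  ext p
  rw [mem_pareto, mem_pareto]
  simp only [Finset.mem_union]
  constructor
  · rintro ⟨hp, hmin⟩
    refine ⟨hp.imp_left fun h => pareto_subset L h, fun q hq hle => ?_⟩
    rcases hq with hq | hq
    · obtain ⟨r, hr, hrq⟩ := exists_mem_pareto_le hq
      exact le_antisymm hle ((hmin r (Or.inl hr) (hrq.trans hle)).symm.le.trans hrq)
    · exact hmin q (Or.inr hq) hle
  · rintro ⟨hp, hmin⟩
    refine ⟨hp.imp_left fun h => mem_pareto.2 ⟨h, fun q hq => hmin q (Or.inl hq)⟩,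
      fun q hq => hmin q (hq.imp_left fun h => pareto_subset L h)⟩

open Classical in
/-- All tuples generated by the first `t` updates. -/
def tuples {n : ℕ} (v : ℕ → Fin n) (a : ℕ → ℝ) (h : Fin n → ℝ) (t : ℕ) :
    Finset (ℝ × ℝ × Fin n) :=
  (Finset.range t).image fun i => (a i, h (v i), v i)

lemma mem_tuples {n : ℕ} {v : ℕ → Fin n} {a : ℕ → ℝ} {h : Fin n → ℝ} {t : ℕ}
    {p : ℝ × ℝ × Fin n} :
    p ∈ tuples v a h t ↔ ∃ i < t, (a i, h (v i), v i) = p := by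
  simp [tuples]

lemma state_eq_pareto_tuples {n : ℕ} (v : ℕ → Fin n) (Δ : ℕ → ℝ≥0) (y : ℕ → ℝ) (h : Fin n → ℝ)
    (t : ℕ) : state v Δ y h t = pareto (tuples v (fun i => y i / Δ i) h t) := by
  classical
  induction t with
  | zero => simp [state, tuples, pareto]
  | succ t ih =>
    rw [state, ih, pareto_pareto_union]
    congr 1
    ext p
    simp only [Finset.mem_union, mem_tuples, Finset.mem_singleton]
    constructor
    · rintro (⟨i, hi, rfl⟩ | rfl)
      · exact ⟨i, by omega, rfl⟩
      · exact ⟨t, by omega, rfl⟩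
    · rintro ⟨i, hi, rfl⟩
      rcases Nat.lt_succ_iff_lt_or_eq.1 hi with hi | rfl
      · exact Or.inl ⟨i, hi, rfl⟩
      · exact Or.inr rfl

/-! ### The smallest value generated for every coordinate -/

/-- The updates of the coordinate `u` among the first `t` updates. -/
def updates {n : ℕ} (v : ℕ → Fin n) (t : ℕ) (u : Fin n) : Finset ℕ :=
  (Finset.range t).filter fun i => v i = u

lemma mem_updates {n : ℕ} {v : ℕ → Fin n} {t : ℕ} {u : Fin n} {i : ℕ} :
    i ∈ updates v t u ↔ i < t ∧ v i = u := by
  simp [updates]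

lemma vec_eq_sum_updates {n : ℕ} (v : ℕ → Fin n) (Δ : ℕ → ℝ≥0) (t : ℕ) (u : Fin n) :
    vec v Δ t u = ∑ i ∈ updates v t u, Δ i := by
  rw [vec, updates, Finset.sum_filter]

lemma vec_pos_iff {n : ℕ} {v : ℕ → Fin n} {Δ : ℕ → ℝ≥0} (hΔ : ∀ i, 0 < Δ i) {t : ℕ} {u : Fin n} :
    0 < vec v Δ t u ↔ (updates v t u).Nonempty := by
  rw [vec_eq_sum_updates]
  constructor
  · intro h
    by_contra hne
    rw [Finset.not_nonempty_iff_eq_empty] at hne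
    simp [hne] at h
  · exact fun h => Finset.sum_pos (fun i _ => hΔ i) h

/-- The smallest value generated by the updates in `I` (zero if there are none). -/
def minValue (I : Finset ℕ) (a : ℕ → ℝ) : ℝ :=
  if hI : I.Nonempty then I.inf' hI a else 0

lemma lt_minValue_iff {I : Finset ℕ} (hI : I.Nonempty) {a : ℕ → ℝ} {c : ℝ} :
    c < minValue I a ↔ ∀ i ∈ I, c < a i := by
  rw [minValue, dif_pos hI, Finset.lt_inf'_iff]

lemma minValue_le {I : Finset ℕ} {a : ℕ → ℝ} {i : ℕ} (hi : i ∈ I) : minValue I a ≤ a i := by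
  rw [minValue, dif_pos ⟨i, hi⟩]
  exact Finset.inf'_le _ hi

lemma exists_eq_minValue {I : Finset ℕ} (hI : I.Nonempty) (a : ℕ → ℝ) :
    ∃ i ∈ I, a i = minValue I a := by
  obtain ⟨i, hi, h⟩ := Finset.exists_mem_eq_inf' hI a
  exact ⟨i, hi, by rw [minValue, dif_pos hI, h]⟩

lemma measurable_minValue (I : Finset ℕ) : Measurable (minValue I) := by
  by_cases hI : I.Nonempty
  · refine measurable_of_Ioi fun c => ?_
    have : minValue I ⁻¹' Set.Ioi c = ⋂ i ∈ I, {a | c < a i} := by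
      ext a
      simp [lt_minValue_iff hI]
    rw [this]
    exact Finset.measurableSet_biInter _ fun i _ =>
      measurableSet_lt measurable_const (measurable_pi_apply i)
  · have : minValue I = fun _ => 0 := by
      ext a
      rw [minValue, dif_neg hI]
    rw [this]
    exact measurable_const

/-- The elements of `U` whose value of `h` is smaller than those of all elements of `U` that come
earlier in the order given by `m`. -/
def records {ι : Type*} (U : Finset ι) (m h : ι → ℝ) : Finset ι :=
  open Classical in U.filter fun u => ∀ w ∈ U, m w < m u → h u < h w

lemma mem_records {ι : Type*} {U : Finset ι} {m h : ι → ℝ} {u : ι} :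
    u ∈ records U m h ↔ u ∈ U ∧ ∀ w ∈ U, m w < m u → h u < h w := by
  simp [records]

lemma minValue_injOn {n : ℕ} {v : ℕ → Fin n} {a : ℕ → ℝ} {t : ℕ} (ha : Function.Injective a)
    {u w : Fin n} (hu : (updates v t u).Nonempty) (hw : (updates v t w).Nonempty)
    (h : minValue (updates v t u) a = minValue (updates v t w) a) : u = w := by
  obtain ⟨i, hi, hi'⟩ := exists_eq_minValue hu a
  obtain ⟨j, hj, hj'⟩ := exists_eq_minValue hw a
  rw [← hi', ← hj'] at h
  rw [← (mem_updates.1 hi).2, ← (mem_updates.1 hj).2, ha h]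

/-- A frontier tuple must carry the minimum of its coordinate, because the minimizing tuple has the
same hash. Between minimizing tuples of distinct coordinates, whose first entries differ by
injectivity, minimality is the record condition. -/
lemma card_pareto_tuples {n : ℕ} {v : ℕ → Fin n} {a : ℕ → ℝ} (ha : Function.Injective a)
    (h : Fin n → ℝ) (t : ℕ) {U : Finset (Fin n)} (hU : ∀ u, u ∈ U ↔ (updates v t u).Nonempty) :
    (pareto (tuples v a h t)).card =
      (records U (fun u => minValue (updates v t u) a) h).card := by
  classical
  set m : Fin n → ℝ := fun u => minValue (updates v t u) a with hm
  have himage : pareto (tuples v a h t) = (records U m h).image fun u => (m u, h u, u) := by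
    ext p
    rw [mem_pareto, Finset.mem_image]
    constructor
    · rintro ⟨hp, hmin⟩
      obtain ⟨i, hi, rfl⟩ := mem_tuples.1 hp
      have hiu : i ∈ updates v t (v i) := mem_updates.2 ⟨hi, rfl⟩
      obtain ⟨j, hj, hj'⟩ := exists_eq_minValue ⟨i, hiu⟩ a
      obtain ⟨hjt, hjv⟩ := mem_updates.1 hj
      have hmi : m (v i) = a i := by
        have := hmin _ (mem_tuples.2 ⟨j, hjt, rfl⟩)
          ⟨by simpa [point, hj'] using minValue_le hiu, by simp [point, hjv]⟩
        simp only [point, Prod.mk.injEq] at this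
        rw [hm, ← this.1, hj']
      refine ⟨v i, mem_records.2 ⟨(hU _).2 ⟨i, hiu⟩, fun w hw hlt => ?_⟩, by rw [hmi]⟩
      obtain ⟨k, hk, hk'⟩ := exists_eq_minValue ((hU w).1 hw) a
      obtain ⟨hkt, rfl⟩ := mem_updates.1 hk
      by_contra hle
      rw [hmi] at hlt
      have := hmin _ (mem_tuples.2 ⟨k, hkt, rfl⟩) ⟨by simpa [point, hk'] using hlt.le,
        by simpa [point] using hle⟩
      simp only [point, Prod.mk.injEq] at this
      have h1 : a k = m (v k) := hk'
      linarith [this.1]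
    · rintro ⟨u, hu, rfl⟩
      obtain ⟨huU, hrec⟩ := mem_records.1 hu
      obtain ⟨i, hi, hi'⟩ := exists_eq_minValue ((hU u).1 huU) a
      obtain ⟨hit, rfl⟩ := mem_updates.1 hi
      refine ⟨mem_tuples.2 ⟨i, hit, by rw [hi']⟩, fun q hq hle => ?_⟩
      obtain ⟨j, hj, rfl⟩ := mem_tuples.1 hq
      have hjw : j ∈ updates v t (v j) := mem_updates.2 ⟨hj, rfl⟩
      have h1 : a j ≤ m (v i) := hle.1
      have h2 : h (v j) ≤ h (v i) := hle.2
      have h3 : m (v j) ≤ a j := minValue_le hjw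
      have hjU : v j ∈ U := (hU _).2 ⟨j, hjw⟩
      rcases (h3.trans h1).lt_or_eq with hlt | heq
      · exact absurd (hrec _ hjU hlt) (not_lt.2 h2)
      · have hvv : v j = v i := minValue_injOn ha ⟨j, hjw⟩ ⟨i, hi⟩ heq
        simp only [point, hvv, Prod.mk.injEq, and_true]
        exact le_antisymm h1 (heq ▸ h3)
  rw [himage, Finset.card_image_of_injective]
  intro u w huw
  simp only [Prod.mk.injEq] at huw
  exact huw.2.2

/-! ### The query -/

/-- If `l` is monotone and the coordinate `u` has the strictly smallest value of `l`, then the query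
returns `u`. -/
lemma sample_pareto_tuples {n : ℕ} {v : ℕ → Fin n} {a : ℕ → ℝ} {h : Fin n → ℝ} {t : ℕ}
    {l : ℝ → ℝ → ℝ≥0∞} (hl : ∀ a a' b b', a ≤ a' → b ≤ b' → l a b ≤ l a' b') {u : Fin n}
    (hu : (updates v t u).Nonempty)
    (hmin : ∀ w, w ≠ u → (updates v t w).Nonempty →
      l (minValue (updates v t u) a) (h u) < l (minValue (updates v t w) a) (h w)) :
    sample l (pareto (tuples v a h t)) = some u := by
  classical
  obtain ⟨i, hi, hi'⟩ := exists_eq_minValue hu a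
  obtain ⟨hit, rfl⟩ := mem_updates.1 hi
  obtain ⟨q, hq, hqle⟩ := exists_mem_pareto_le
    (mem_tuples.2 ⟨i, hit, rfl⟩ : (a i, h (v i), v i) ∈ tuples v a h t)
  have hne : (pareto (tuples v a h t)).Nonempty := ⟨q, hq⟩
  rw [sample, dif_pos hne]
  have hspec := Classical.choose_spec
    ((pareto (tuples v a h t)).exists_min_image (fun p => l p.1 p.2.1) hne)
  set p := Classical.choose
    ((pareto (tuples v a h t)).exists_min_image (fun p => l p.1 p.2.1) hne)
  obtain ⟨j, hjt, hj⟩ := mem_tuples.1 (pareto_subset _ hspec.1)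
  have hjw : j ∈ updates v t (v j) := mem_updates.2 ⟨hjt, rfl⟩
  congr 1
  by_contra hne'
  have hpv : p.2.2 = v j := by rw [← hj]
  rw [hpv] at hne'
  -- The chosen tuple `p` belongs to `v j` and `q` dominates the best tuple of `v i`. Hence the
  -- level of `v j` is at most that of `v i`, against `hmin`; the way ties are broken plays no role.
  have h1 : l (minValue (updates v t (v j)) a) (h (v j)) ≤ l p.1 p.2.1 := by
    rw [← hj]
    exact hl _ _ _ _ (minValue_le hjw) le_rfl
  have h2 : l p.1 p.2.1 ≤ l (minValue (updates v t (v i)) a) (h (v i)) := by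
    refine (hspec.2 q hq).trans (hl _ _ _ _ ?_ hqle.2)
    rw [← hi']
    exact hqle.1
  exact absurd (hmin _ hne' ⟨j, hjw⟩) (not_lt.2 (h1.trans h2))

section

/-! ### Records of independent uniform variables -/

/-- The uniform distribution on the unit interval. -/
abbrev unitUniform : Measure ℝ := volume.restrict (Set.Icc (0 : ℝ) 1)

instance : IsProbabilityMeasure unitUniform := ⟨by simp⟩

lemma lintegral_Icc_ofReal {a b : ℝ} (hab : a ≤ b) {f : ℝ → ℝ} (hf : Continuous f)
    (h0 : ∀ y ∈ Set.Icc a b, 0 ≤ f y) :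
    ∫⁻ y in Set.Icc a b, ENNReal.ofReal (f y) = ENNReal.ofReal (∫ y in a..b, f y) := by
  rw [intervalIntegral.integral_of_le hab, ← integral_Icc_eq_integral_Ioc,
    ofReal_integral_eq_lintegral_ofReal hf.integrableOn_Icc]
  exact (ae_restrict_iff' measurableSet_Icc).2 (ae_of_all _ h0)

lemma lintegral_unitUniform_one_sub_pow (k : ℕ) :
    ∫⁻ y, ENNReal.ofReal (1 - y) ^ k ∂unitUniform = ENNReal.ofReal (1 / (k + 1)) := by
  have h1 : ∫⁻ y, ENNReal.ofReal (1 - y) ^ k ∂unitUniform =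
      ∫⁻ y in Set.Icc (0 : ℝ) 1, ENNReal.ofReal ((1 - y) ^ k) := by
    refine setLIntegral_congr_fun measurableSet_Icc fun y hy => ?_
    exact (ENNReal.ofReal_pow (by linarith [hy.2]) k).symm
  rw [h1, lintegral_Icc_ofReal zero_le_one (by fun_prop)
    fun y hy => pow_nonneg (by linarith [hy.2]) k]
  congr 1
  rw [intervalIntegral.integral_comp_sub_left (fun y => y ^ k) 1]
  simp

lemma unitUniform_Ioi {y : ℝ} (hy : y ∈ Set.Icc (0 : ℝ) 1) :
    unitUniform (Set.Ioi y) = ENNReal.ofReal (1 - y) := by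
  rw [Measure.restrict_apply measurableSet_Ioi]
  have : Set.Ioi y ∩ Set.Icc 0 1 = Set.Ioc y 1 := by
    ext z
    simp only [Set.mem_inter_iff, Set.mem_Ioi, Set.mem_Icc, Set.mem_Ioc]
    constructor
    · exact fun h => ⟨h.1, h.2.2⟩
    · exact fun h => ⟨h.1, (hy.1.trans_lt h.1).le, h.2⟩
  rw [this, Real.volume_Ioc]

variable {ι : Type*}

/-- The records whose value of `h` is smaller than `x`. -/
def recordsBelow (U : Finset ι) (m : ι → ℝ) (x : ℝ) (h : ι → ℝ) : Finset ι :=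
  (records U m h).filter fun u => h u < x

lemma mem_recordsBelow {U : Finset ι} {m h : ι → ℝ} {x : ℝ} {u : ι} :
    u ∈ recordsBelow U m x h ↔ u ∈ U ∧ (∀ w ∈ U, m w < m u → h u < h w) ∧ h u < x := by
  simp [recordsBelow, mem_records, and_assoc]

lemma measurable_card_filter {Ω : Type*} [MeasurableSpace Ω] (U : Finset ι) (p : ι → Ω → Prop)
    [∀ ω, DecidablePred fun u => p u ω] (hp : ∀ u ∈ U, MeasurableSet {ω | p u ω}) :
    Measurable fun ω => (U.filter fun u => p u ω).card := by
  classical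
  simp only [Finset.card_filter]
  exact Finset.measurable_sum _ fun u hu =>
    Measurable.ite (hp u hu) measurable_const measurable_const

lemma measurable_card_records (U : Finset ι) :
    Measurable fun p : (ι → ℝ) × (ι → ℝ) => (records U p.1 p.2).card := by
  classical
  refine measurable_card_filter U _ fun u _ => ?_
  simp only [Set.ofPred_forall]
  refine Finset.measurableSet_biInter _ fun w _ => ?_
  refine MeasurableSet.imp ?_ ?_
  · exact measurableSet_lt (by fun_prop) (by fun_prop)
  · exact measurableSet_lt (by fun_prop) (by fun_prop)

lemma measurable_card_records_right (U : Finset ι) (m : ι → ℝ) :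
    Measurable fun h => (records U m h).card := by
  have h : Measurable fun h : ι → ℝ => (m, h) := measurable_prodMk_left
  exact (measurable_card_records U).comp h

lemma measurable_card_recordsBelow (U : Finset ι) (m : ι → ℝ) (x : ℝ) :
    Measurable fun h => (recordsBelow U m x h).card := by
  classical
  have : ∀ h, (recordsBelow U m x h).card =
      (U.filter fun u => (∀ w ∈ U, m w < m u → h u < h w) ∧ h u < x).card := by
    intro h
    congr 1
    ext u
    simp [mem_recordsBelow]
  simp only [this]
  refine measurable_card_filter U _ fun u _ =>
    MeasurableSet.inter (s₁ := {h : ι → ℝ | ∀ w ∈ U, m w < m u → h u < h w})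
      (s₂ := {h : ι → ℝ | h u < x}) ?_ ?_
  · simp only [Set.ofPred_forall]
    exact Finset.measurableSet_biInter _ fun w _ => MeasurableSet.iInter fun _ =>
      measurableSet_lt (measurable_pi_apply u) (measurable_pi_apply w)
  · exact measurableSet_lt (measurable_pi_apply u) measurable_const

/-- The element `w` comes first. If its value is below the threshold, it is a record and becomes the
new threshold; otherwise the old threshold already imposes more than `w` does. -/
lemma recordsBelow_insert [DecidableEq ι] {U : Finset ι} {m : ι → ℝ} {w : ι}
    (hw : ∀ u ∈ U, m w < m u) (x : ℝ) (h : ι → ℝ) :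
    recordsBelow (insert w U) m x h =
      if h w < x then insert w (recordsBelow U m (h w) h) else recordsBelow U m x h := by
  ext u
  split_ifs with hx
  · simp only [mem_recordsBelow, Finset.mem_insert, forall_eq_or_imp]
    constructor
    · rintro ⟨rfl | hu, ⟨h1, h2⟩, h3⟩
      · exact Or.inl rfl
      · exact Or.inr ⟨hu, h2, h1 (hw u hu)⟩
    · rintro (rfl | ⟨hu, h2, h1⟩)
      · exact ⟨Or.inl rfl, ⟨fun hlt => absurd hlt (lt_irrefl _),
          fun v hv hlt => absurd hlt (hw v hv).not_gt⟩, hx⟩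
      · exact ⟨Or.inr hu, ⟨fun _ => h1, h2⟩, h1.trans hx⟩
  · simp only [mem_recordsBelow, Finset.mem_insert, forall_eq_or_imp]
    constructor
    · rintro ⟨rfl | hu, ⟨h1, h2⟩, h3⟩
      · exact absurd h3 hx
      · exact ⟨hu, h2, h3⟩
    · rintro ⟨hu, h2, h3⟩
      exact ⟨Or.inr hu, ⟨fun _ => h3.trans_le (not_lt.1 hx), h2⟩, h3⟩

lemma records_insert_min [DecidableEq ι] {U : Finset ι} {m : ι → ℝ} {w : ι}
    (hw : ∀ u ∈ U, m w < m u) (h : ι → ℝ) :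
    records (insert w U) m h = insert w (recordsBelow U m (h w) h) := by
  ext u
  simp only [mem_recordsBelow, mem_records, Finset.mem_insert, forall_eq_or_imp]
  constructor
  · rintro ⟨rfl | hu, h1, h2⟩
    · exact Or.inl rfl
    · exact Or.inr ⟨hu, h2, h1 (hw u hu)⟩
  · rintro (rfl | ⟨hu, h2, h1⟩)
    · exact ⟨Or.inl rfl, fun hlt => absurd hlt (lt_irrefl _),
        fun v hv hlt => absurd hlt (hw v hv).not_gt⟩
    · exact ⟨Or.inr hu, fun _ => h1, h2⟩

/-- An element that comes last cannot spoil any other record. -/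
lemma records_insert_max [DecidableEq ι] {U : Finset ι} {m : ι → ℝ} {w : ι}
    (hw : ∀ u ∈ U, m u < m w) (h : ι → ℝ) [Decidable (∀ u ∈ U, h w < h u)] :
    records (insert w U) m h =
      if ∀ u ∈ U, h w < h u then insert w (records U m h) else records U m h := by
  ext u
  split_ifs with hx
  · simp only [mem_records, Finset.mem_insert, forall_eq_or_imp]
    constructor
    · rintro ⟨rfl | hu, h1, h2⟩
      · exact Or.inl rfl
      · exact Or.inr ⟨hu, h2⟩
    · rintro (rfl | ⟨hu, h2⟩)
      · exact ⟨Or.inl rfl, fun hlt => absurd hlt (lt_irrefl _), fun v hv _ => hx v hv⟩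
      · exact ⟨Or.inr hu, fun hlt => absurd hlt (hw u hu).not_gt, h2⟩
  · simp only [mem_records, Finset.mem_insert, forall_eq_or_imp]
    constructor
    · rintro ⟨rfl | hu, h1, h2⟩
      · exact absurd (fun v hv => h2 v hv (hw v hv)) hx
      · exact ⟨hu, h2⟩
    · rintro ⟨hu, h2⟩
      exact ⟨Or.inr hu, fun hlt => absurd hlt (hw u hu).not_gt, h2⟩

lemma updateFinset_update_of_notMem [DecidableEq ι] {U : Finset ι} {w : ι} (hw : w ∉ U) (h : ι → ℝ)
    (y : ℝ) (z : U → ℝ) : Function.updateFinset (Function.update h w y) U z w = y := by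
  simp [Function.updateFinset, hw]

/-- One step of the recursion for the mean of `2 ^ (number of records below x)`, with `y` the value
of the first element: a new record doubles the power and lowers the threshold to `y`. The form `1 +
k x` is preserved since `∫₀ˣ 2(1 + k y) dy + (1 - x)(1 + k x) = 1 + (k + 1) x`. -/
lemma lintegral_two_pow_step (k : ℕ) {x : ℝ} (hx : x ∈ Set.Icc (0 : ℝ) 1) :
    ∫⁻ y, (if y < x then 2 * (1 + (k : ℝ≥0∞) * ENNReal.ofReal y)
        else 1 + (k : ℝ≥0∞) * ENNReal.ofReal x) ∂unitUniform =
      1 + ((k + 1 : ℕ) : ℝ≥0∞) * ENNReal.ofReal x := by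
  have hsplit : Set.Icc (0 : ℝ) 1 = Set.Ico 0 x ∪ Set.Icc x 1 :=
    (Set.Ico_union_Icc_eq_Icc hx.1 hx.2).symm
  rw [unitUniform, hsplit, lintegral_union measurableSet_Icc]
  swap
  · exact Set.disjoint_left.2 fun y hy hy' => absurd hy.2 (not_lt.2 hy'.1)
  have h1 : ∫⁻ y in Set.Ico 0 x, (if y < x then 2 * (1 + (k : ℝ≥0∞) * ENNReal.ofReal y)
        else 1 + (k : ℝ≥0∞) * ENNReal.ofReal x) = ENNReal.ofReal (2 * x + k * x ^ 2) := by
    have : ∫⁻ y in Set.Ico 0 x, (if y < x then 2 * (1 + (k : ℝ≥0∞) * ENNReal.ofReal y)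
        else 1 + (k : ℝ≥0∞) * ENNReal.ofReal x) =
        ∫⁻ y in Set.Ico 0 x, ENNReal.ofReal (2 * (1 + k * y)) := by
      refine setLIntegral_congr_fun measurableSet_Ico fun y hy => ?_
      have hy0 : 0 ≤ y := hy.1
      simp only [if_pos hy.2]
      rw [ENNReal.ofReal_mul zero_le_two, ENNReal.ofReal_add zero_le_one (by positivity),
        ENNReal.ofReal_mul (by positivity)]
      simp
    rw [this, setLIntegral_congr Ico_ae_eq_Icc, lintegral_Icc_ofReal hx.1 (by fun_prop)]
    · congr 1
      simp only [intervalIntegral.integral_const_mul]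
      rw [intervalIntegral.integral_add (by simp) (by
        exact (Continuous.intervalIntegrable (by fun_prop) _ _))]
      rw [intervalIntegral.integral_const_mul, integral_id, intervalIntegral.integral_const]
      simp
      ring
    · intro y hy
      have hy0 : 0 ≤ y := hy.1
      positivity
  have h2 : ∫⁻ y in Set.Icc x 1, (if y < x then 2 * (1 + (k : ℝ≥0∞) * ENNReal.ofReal y)
        else 1 + (k : ℝ≥0∞) * ENNReal.ofReal x) = ENNReal.ofReal ((1 + k * x) * (1 - x)) := by
    have : ∫⁻ y in Set.Icc x 1, (if y < x then 2 * (1 + (k : ℝ≥0∞) * ENNReal.ofReal y)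
        else 1 + (k : ℝ≥0∞) * ENNReal.ofReal x) =
        ∫⁻ _ in Set.Icc x 1, (1 + (k : ℝ≥0∞) * ENNReal.ofReal x) := by
      refine setLIntegral_congr_fun measurableSet_Icc fun y hy => ?_
      simp only [if_neg (not_lt.2 hy.1)]
    have hx0 := hx.1
    rw [this, setLIntegral_const, Real.volume_Icc, ENNReal.ofReal_mul (by positivity),
      ENNReal.ofReal_add zero_le_one (by positivity), ENNReal.ofReal_mul (by positivity)]
    simp
  have hx0 := hx.1
  have hx1 : 0 ≤ 1 - x := by linarith [hx.2]
  rw [h1, h2, ← ENNReal.ofReal_add (by positivity) (by positivity)]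
  have h3 : (1 : ℝ≥0∞) + ((k + 1 : ℕ) : ℝ≥0∞) * ENNReal.ofReal x =
      ENNReal.ofReal (1 + ((k + 1 : ℕ) : ℝ) * x) := by
    rw [ENNReal.ofReal_add zero_le_one (by positivity), ENNReal.ofReal_mul (by positivity),
      ENNReal.ofReal_natCast, ENNReal.ofReal_one]
  rw [h3]
  congr 1
  push_cast
  ring

/-- Induction that adds the element coming first in the order of `m`. Carrying an arbitrary
threshold `x` makes the recursion close, since the remaining elements see the value of the first as
their threshold. -/
lemma lmarginal_two_pow_card_recordsBelow [DecidableEq ι] (U : Finset ι) (m : ι → ℝ)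
    (hm : Set.InjOn m U) : ∀ x ∈ Set.Icc (0 : ℝ) 1, ∀ h : ι → ℝ,
    (∫⋯∫⁻_U, (fun h => (2 : ℝ≥0∞) ^ (recordsBelow U m x h).card) ∂fun _ => unitUniform) h =
      1 + (U.card : ℝ≥0∞) * ENNReal.ofReal x := by
  induction U using Finset.induction_on_min_value (f := m) with
  | empty => intro x _ h; simp [recordsBelow, records]
  | insert w U hwU hle ih =>
    have hlt : ∀ u ∈ U, m w < m u := fun u hu => (hle u hu).lt_of_ne fun heq => hwU (by
      have := hm (by simp) (by simp [hu]) heq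
      rwa [this])
    have ih' := ih (hm.mono (by simp))
    intro x hx h
    have hmeas : ∀ (V : Finset ι) (x : ℝ),
        Measurable fun h => (2 : ℝ≥0∞) ^ (recordsBelow V m x h).card := fun V x =>
      (measurable_from_nat (f := fun j : ℕ => (2 : ℝ≥0∞) ^ j)).comp
        (measurable_card_recordsBelow V m x)
    rw [lmarginal_insert _ (hmeas _ x) hwU, Finset.card_insert_of_notMem hwU,
      ← lintegral_two_pow_step U.card hx]
    refine setLIntegral_congr_fun measurableSet_Icc fun y hy => ?_
    have hwR : ∀ (x : ℝ) (h : ι → ℝ), w ∉ recordsBelow U m x h := fun x h hw =>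
      hwU (mem_recordsBelow.1 hw).1
    split_ifs with hyx
    · rw [← ih' y hy (Function.update h w y)]
      simp only [lmarginal]
      rw [← lintegral_const_mul]
      · refine lintegral_congr fun z => ?_
        rw [recordsBelow_insert hlt, updateFinset_update_of_notMem hwU, if_pos hyx,
          Finset.card_insert_of_notMem (hwR _ _), pow_succ']
      · exact (hmeas U y).comp measurable_updateFinset
    · rw [← ih' x hx (Function.update h w y)]
      simp only [lmarginal]
      refine lintegral_congr fun z => ?_
      rw [recordsBelow_insert hlt, updateFinset_update_of_notMem hwU, if_neg hyx]

/-- The generating function of the number of records, at the point `2`. -/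
theorem lintegral_two_pow_card_records [Fintype ι] (U : Finset ι) (m : ι → ℝ)
    (hm : Set.InjOn m U) :
    ∫⁻ h, (2 : ℝ≥0∞) ^ (records U m h).card ∂Measure.pi (fun _ : ι => unitUniform) =
      U.card + 1 := by
  classical
  rcases U.eq_empty_or_nonempty with rfl | hU
  · simp [records]
  obtain ⟨w, hw, hle⟩ := U.exists_min_image m hU
  obtain ⟨V, hwV, rfl⟩ : ∃ V, w ∉ V ∧ U = insert w V :=
    ⟨U.erase w, by simp, (Finset.insert_erase hw).symm⟩
  have hlt : ∀ u ∈ V, m w < m u := fun u hu =>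
    (hle u (by simp [hu])).lt_of_ne fun heq => hwV (by
      have := hm (by simp) (by simp [hu]) heq
      rwa [this])
  have hmeas1 : Measurable fun h => (2 : ℝ≥0∞) ^ (records (insert w V) m h).card :=
    (measurable_from_nat (f := fun j : ℕ => (2 : ℝ≥0∞) ^ j)).comp
      (measurable_card_records_right (insert w V) m)
  have key : (∫⋯∫⁻_(insert w V), (fun h => (2 : ℝ≥0∞) ^ (records (insert w V) m h).card)
        ∂fun _ : ι => unitUniform) =
      ∫⋯∫⁻_(insert w V), (fun _ => ((insert w V).card : ℝ≥0∞) + 1) ∂fun _ : ι => unitUniform := by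
    ext h
    rw [lmarginal_insert _ hmeas1 hwV]
    -- The vacuous case split imitates `lintegral_two_pow_step` at `x = 1`; the two integrands then
    -- differ only at the null point `y = 1`.
    have h1 : ∀ y ∈ Set.Icc (0 : ℝ) 1,
        (∫⋯∫⁻_V, (fun h => (2 : ℝ≥0∞) ^ (records (insert w V) m h).card)
          ∂fun _ : ι => unitUniform) (Function.update h w y) =
        if y < 1 then 2 * (1 + (V.card : ℝ≥0∞) * ENNReal.ofReal y)
          else 2 * (1 + (V.card : ℝ≥0∞) * ENNReal.ofReal y) := by
      intro y hy
      rw [ite_self, ← lmarginal_two_pow_card_recordsBelow V m (hm.mono (by simp)) y hy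
        (Function.update h w y)]
      simp only [lmarginal]
      rw [← lintegral_const_mul]
      · refine lintegral_congr fun z => ?_
        rw [records_insert_min hlt, updateFinset_update_of_notMem hwV,
          Finset.card_insert_of_notMem fun hw => hwV (mem_recordsBelow.1 hw).1, pow_succ']
      · exact (measurable_from_nat (f := fun j : ℕ => (2 : ℝ≥0∞) ^ j)).comp
          ((measurable_card_recordsBelow V m y).comp measurable_updateFinset)
    rw [setLIntegral_congr_fun measurableSet_Icc h1]
    have h2 := lintegral_two_pow_step V.card (x := 1) (by simp)
    have h3 : ∫⁻ y in Set.Icc (0 : ℝ) 1,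
        (if y < 1 then 2 * (1 + (V.card : ℝ≥0∞) * ENNReal.ofReal y)
          else 2 * (1 + (V.card : ℝ≥0∞) * ENNReal.ofReal y)) =
        ∫⁻ y, (if y < 1 then 2 * (1 + (V.card : ℝ≥0∞) * ENNReal.ofReal y)
          else 1 + (V.card : ℝ≥0∞) * ENNReal.ofReal 1) ∂unitUniform := by
      refine lintegral_congr_ae ?_
      have : ∀ᵐ y ∂unitUniform, y ≠ 1 := by
        refine ae_restrict_of_ae ?_
        simp [ae_iff]
      filter_upwards [this, ae_restrict_mem measurableSet_Icc] with y hy hy'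
      have : y < 1 := lt_of_le_of_ne hy'.2 hy
      simp [this]
    rw [h3, h2, Finset.card_insert_of_notMem hwV]
    simp [lmarginal, add_comm]
  rw [lintegral_eq_of_lmarginal_eq _ hmeas1 measurable_const key]
  simp

/-- Given `h w = y`, the other values all exceed `y` with probability `(1 - y) ^ |U|`, which
integrates to `1 / (|U| + 1)`. -/
lemma pi_unitUniform_forall_lt [Fintype ι] {U : Finset ι} {w : ι} (hw : w ∉ U) :
    Measure.pi (fun _ : ι => unitUniform) {h | ∀ u ∈ U, h w < h u} =
      ENNReal.ofReal (1 / (U.card + 1)) := by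
  classical
  have hmeas : MeasurableSet {h : ι → ℝ | ∀ u ∈ U, h w < h u} := by
    simp only [Set.ofPred_forall]
    exact Finset.measurableSet_biInter _ fun u _ =>
      measurableSet_lt (measurable_pi_apply w) (measurable_pi_apply u)
  rw [← lintegral_indicator_one hmeas]
  have key : (∫⋯∫⁻_(insert w U), ({h : ι → ℝ | ∀ u ∈ U, h w < h u}.indicator 1)
        ∂fun _ : ι => unitUniform) =
      ∫⋯∫⁻_(insert w U), (fun _ => ENNReal.ofReal (1 / (U.card + 1)))
        ∂fun _ : ι => unitUniform := by
    ext h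
    rw [lmarginal_insert _ (measurable_one.indicator hmeas) hw]
    have h1 : ∀ y ∈ Set.Icc (0 : ℝ) 1,
        (∫⋯∫⁻_U, ({h : ι → ℝ | ∀ u ∈ U, h w < h u}.indicator 1)
          ∂fun _ : ι => unitUniform) (Function.update h w y) = ENNReal.ofReal (1 - y) ^ U.card := by
      intro y hy
      have hset : MeasurableSet (Set.univ.pi fun _ : U => Set.Ioi y) :=
        MeasurableSet.univ_pi fun _ => measurableSet_Ioi
      have : (∫⋯∫⁻_U, ({h : ι → ℝ | ∀ u ∈ U, h w < h u}.indicator 1)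
          ∂fun _ : ι => unitUniform) (Function.update h w y) =
          ∫⁻ z, (Set.univ.pi fun _ : U => Set.Ioi y).indicator 1 z
            ∂Measure.pi (fun _ : U => unitUniform) := by
        simp only [lmarginal]
        refine lintegral_congr fun z => ?_
        have hiff : Function.updateFinset (Function.update h w y) U z ∈
            {h : ι → ℝ | ∀ u ∈ U, h w < h u} ↔ z ∈ Set.univ.pi fun _ : U => Set.Ioi y := by
          simp only [Set.mem_ofPred_eq, updateFinset_update_of_notMem hw, Set.mem_pi, Set.mem_univ,
            true_imp_iff, Set.mem_Ioi, Subtype.forall]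
          refine forall₂_congr fun u hu => ?_
          simp [Function.updateFinset, hu]
        simp only [Set.indicator, hiff]
        rfl
      rw [this, lintegral_indicator_one hset, Measure.pi_pi]
      simp [unitUniform_Ioi hy]
    rw [setLIntegral_congr_fun measurableSet_Icc h1, lintegral_unitUniform_one_sub_pow]
    simp [lmarginal]
  rw [lintegral_eq_of_lmarginal_eq _ (measurable_one.indicator hmeas) measurable_const key]
  simp

/-- The expected number of records is a harmonic number. -/
theorem lintegral_card_records [Fintype ι] (U : Finset ι) (m : ι → ℝ) (hm : Set.InjOn m U) :
    ∫⁻ h, ((records U m h).card : ℝ≥0∞) ∂Measure.pi (fun _ : ι => unitUniform) =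
      ENNReal.ofReal ((harmonic U.card : ℚ) : ℝ) := by
  classical
  -- Here the element that comes last is added: it leaves the other records alone and contributes
  -- the indicator of having the smallest value.
  induction U using Finset.induction_on_max_value (f := m) with
  | empty => simp [records]
  | insert w U hwU hle ih =>
    have hlt : ∀ u ∈ U, m u < m w := fun u hu => (hle u hu).lt_of_ne fun heq => hwU (by
      have := hm (by simp [hu]) (by simp) heq
      rwa [← this])
    have hmeas : MeasurableSet {h : ι → ℝ | ∀ u ∈ U, h w < h u} := by
      simp only [Set.ofPred_forall]
      exact Finset.measurableSet_biInter _ fun u _ =>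
        measurableSet_lt (measurable_pi_apply w) (measurable_pi_apply u)
    have hcard : ∀ h : ι → ℝ, ((records (insert w U) m h).card : ℝ≥0∞) =
        (records U m h).card + {h : ι → ℝ | ∀ u ∈ U, h w < h u}.indicator 1 h := by
      intro h
      rw [records_insert_max hlt]
      split_ifs with hx
      · rw [Set.indicator_of_mem (by exact hx),
          Finset.card_insert_of_notMem fun hw => hwU (mem_records.1 hw).1]
        simp
      · rw [Set.indicator_of_notMem (by exact hx), add_zero]
    simp only [hcard]
    rw [lintegral_add_right _ (measurable_one.indicator hmeas), ih (hm.mono (by simp)),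
      lintegral_indicator_one hmeas, pi_unitUniform_forall_lt hwU,
      Finset.card_insert_of_notMem hwU, harmonic_succ,
      ← ENNReal.ofReal_add (by exact_mod_cast Finset.sum_nonneg fun i _ => by positivity)
        (by positivity)]
    congr 1
    push_cast
    simp

end

section

/-! ### The function `x ↦ e^{-x}` on `[0,∞]` -/

/-- The function `x ↦ e^{-x}` on `[0,∞]`. -/
def expNeg (x : ℝ≥0∞) : ℝ≥0∞ := EReal.exp (-(x : EReal))

lemma expNeg_zero : expNeg 0 = 1 := by simp [expNeg]

lemma expNeg_top : expNeg ∞ = 0 := by simp [expNeg]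

lemma expNeg_coe (x : ℝ≥0) : expNeg x = ENNReal.ofReal (Real.exp (-x)) := by
  rw [expNeg, EReal.coe_nnreal_eq_coe_real, ← EReal.coe_neg, EReal.exp_coe]

lemma expNeg_ofReal {x : ℝ} (hx : 0 ≤ x) :
    expNeg (ENNReal.ofReal x) = ENNReal.ofReal (Real.exp (-x)) := by
  rw [ENNReal.ofReal, expNeg_coe, Real.coe_toNNReal x hx]

lemma expNeg_add (x y : ℝ≥0∞) : expNeg (x + y) = expNeg x * expNeg y := by
  induction x with
  | top => simp [expNeg_top]
  | coe x =>
    induction y with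
    | top => simp [expNeg_top]
    | coe y =>
      rw [← ENNReal.coe_add, expNeg_coe, expNeg_coe, expNeg_coe,
        ← ENNReal.ofReal_mul (Real.exp_pos _).le, ← Real.exp_add]
      congr 2
      push_cast
      ring

lemma expNeg_sum {ι : Type*} (s : Finset ι) (f : ι → ℝ≥0∞) :
    expNeg (∑ i ∈ s, f i) = ∏ i ∈ s, expNeg (f i) := by
  classical
  induction s using Finset.induction_on with
  | empty => simp [expNeg_zero]
  | insert i s hi ih => rw [Finset.sum_insert hi, Finset.prod_insert hi, expNeg_add, ih]

lemma strictAnti_expNeg : StrictAnti expNeg := fun x y hxy => by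
  rw [expNeg, expNeg, EReal.exp_lt_exp_iff, EReal.neg_lt_neg_iff]
  exact EReal.coe_ennreal_lt_coe_ennreal_iff.2 hxy

lemma continuous_expNeg : Continuous expNeg :=
  ENNReal.continuous_exp.comp (continuous_neg.comp continuous_coe_ennreal_ereal)

@[fun_prop]
lemma measurable_expNeg : Measurable expNeg := continuous_expNeg.measurable

lemma expNeg_le_one (x : ℝ≥0∞) : expNeg x ≤ 1 := by
  rw [← expNeg_zero]
  exact strictAnti_expNeg.antitone zero_le

lemma expNeg_ne_top (x : ℝ≥0∞) : expNeg x ≠ ∞ := ((expNeg_le_one x).trans_lt ENNReal.one_lt_top).ne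

/-! ### Exponential variables -/

lemma expMeasure_Ioi {r : ℝ} (hr : 0 < r) {c : ℝ} (hc : 0 ≤ c) :
    expMeasure r (Set.Ioi c) = ENNReal.ofReal (Real.exp (-(r * c))) := by
  have := isProbabilityMeasure_expMeasure hr
  have h1 : expMeasure r (Set.Iic c) = ENNReal.ofReal (1 - Real.exp (-(r * c))) := by
    rw [← ofReal_cdf, cdf_expMeasure_eq hr, if_pos hc]
  rw [← Set.compl_Iic, prob_compl_eq_one_sub measurableSet_Iic, h1, ← ENNReal.ofReal_one,
    ← ENNReal.ofReal_sub]
  · congr 1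
    ring
  · rw [sub_nonneg, Real.exp_le_one_iff]
    nlinarith

/-- The density of rate `g` times `e^{-kx}` is `g / (g + k)` times the density of rate `g + k`. -/
lemma lintegral_expNeg_expMeasure {g k : ℝ≥0} (hg : 0 < g) :
    ∫⁻ x, expNeg (ENNReal.ofReal x * k) ∂expMeasure g = ((g / (g + k) : ℝ≥0) : ℝ≥0∞) := by
  have hgk : 0 < g + k := add_pos_of_pos_of_nonneg hg zero_le
  have hgk' : (0 : ℝ) < g + k := by exact_mod_cast hgk
  have hpdf : ∀ r : ℝ, Measurable (exponentialPDF r) := fun r =>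
    (measurable_exponentialPDFReal r).ennreal_ofReal
  have h1 : expMeasure (g : ℝ) = volume.withDensity (exponentialPDF g) := rfl
  rw [h1, lintegral_withDensity_eq_lintegral_mul _ (hpdf _) (by fun_prop)]
  have h2 : ∀ x : ℝ, (exponentialPDF g * fun x => expNeg (ENNReal.ofReal x * k)) x =
      ((g / (g + k) : ℝ≥0) : ℝ≥0∞) * exponentialPDF ((g + k : ℝ≥0) : ℝ) x := by
    intro x
    rw [Pi.mul_apply]
    rcases lt_or_ge x 0 with hx | hx
    · rw [exponentialPDF_of_neg hx, exponentialPDF_of_neg hx, zero_mul, mul_zero]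
    · rw [exponentialPDF_of_nonneg hx, exponentialPDF_of_nonneg hx,
        ← ENNReal.ofReal_coe_nnreal (p := k), ← ENNReal.ofReal_mul hx,
        expNeg_ofReal (mul_nonneg hx k.coe_nonneg), ← ENNReal.ofReal_coe_nnreal (p := g / (g + k)),
        ← ENNReal.ofReal_mul (by positivity), ← ENNReal.ofReal_mul (by positivity), mul_assoc,
        ← Real.exp_add]
      congr 1
      push_cast
      rw [← mul_assoc, div_mul_cancel₀ _ hgk'.ne']
      ring_nf
  simp only [h2]
  have h3 : ∫⁻ x, exponentialPDF ((g + k : ℝ≥0) : ℝ) x = 1 :=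
    lintegral_exponentialPDF_eq_one (by exact_mod_cast hgk)
  rw [lintegral_const_mul _ (hpdf _), h3, mul_one]

variable {Ω : Type*} [MeasurableSpace Ω] {P : Measure Ω}

lemma map_eq_map_expMeasure [IsProbabilityMeasure P] {T : Ω → ℝ≥0∞} (hT : Measurable T) {g : ℝ≥0}
    (hg : 0 < g) (hs : ∀ s : ℝ≥0, P {ω | s < T ω} = expNeg (s * g)) :
    P.map T = (expMeasure g).map ENNReal.ofReal := by
  have hg' : (0 : ℝ) < g := by exact_mod_cast hg
  have := isProbabilityMeasure_expMeasure hg'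
  have h1 : IsProbabilityMeasure (P.map T) := Measure.isProbabilityMeasure_map hT.aemeasurable
  have h2 : IsProbabilityMeasure ((expMeasure g).map ENNReal.ofReal) :=
    Measure.isProbabilityMeasure_map ENNReal.measurable_ofReal.aemeasurable
  refine Measure.ext_of_Iic _ _ fun s => ?_
  induction s with
  | top => simp
  | coe s =>
    rw [← compl_compl (Set.Iic (s : ℝ≥0∞)), prob_compl_eq_one_sub measurableSet_Iic.compl,
      prob_compl_eq_one_sub measurableSet_Iic.compl, Set.compl_Iic,
      Measure.map_apply hT measurableSet_Ioi,
      Measure.map_apply ENNReal.measurable_ofReal measurableSet_Ioi]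
    have h3 : ENNReal.ofReal ⁻¹' Set.Ioi (s : ℝ≥0∞) = Set.Ioi (s : ℝ) := by
      ext x
      rw [Set.mem_preimage, Set.mem_Ioi, Set.mem_Ioi, ← ENNReal.ofReal_coe_nnreal,
        ENNReal.ofReal_lt_ofReal_iff']
      exact ⟨fun h => h.1, fun h => ⟨h, s.coe_nonneg.trans_lt h⟩⟩
    rw [h3, expMeasure_Ioi hg' s.coe_nonneg]
    have h4 : P (T ⁻¹' Set.Ioi (s : ℝ≥0∞)) = expNeg (s * g) := hs s
    rw [h4, ← ENNReal.coe_mul, expNeg_coe]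
    congr 4
    push_cast
    ring

/-- Conditioning on `T` turns the probability into the mean of `e^{-kT}`. The rate `k` may be zero,
in which case `W` is almost surely infinite. -/
lemma measure_lt_of_indepFun_exponential [IsProbabilityMeasure P] {T W : Ω → ℝ≥0∞}
    (hT : Measurable T) (hW : Measurable W) (hTW : IndepFun T W P) {g k : ℝ≥0} (hg : 0 < g)
    (hTs : ∀ s : ℝ≥0, P {ω | s < T ω} = expNeg (s * g))
    (hWs : ∀ s : ℝ≥0, P {ω | s < W ω} = expNeg (s * k)) :
    P {ω | T ω < W ω} = ((g / (g + k) : ℝ≥0) : ℝ≥0∞) := by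
  have hlt : MeasurableSet {p : ℝ≥0∞ × ℝ≥0∞ | p.1 < p.2} :=
    measurableSet_lt measurable_fst measurable_snd
  have h0 : P {ω | T ω < W ω} = P.map (fun ω => (T ω, W ω)) {p | p.1 < p.2} :=
    (Measure.map_apply (hT.prodMk hW) hlt).symm
  have hmeas : Measurable fun x => P.map W (Prod.mk x ⁻¹' {p : ℝ≥0∞ × ℝ≥0∞ | p.1 < p.2}) :=
    measurable_measure_prodMk_left hlt
  rw [h0, hTW.map_prod_eq_prod_map_map hT.aemeasurable hW.aemeasurable, Measure.prod_apply hlt,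
    map_eq_map_expMeasure hT hg hTs, lintegral_map hmeas ENNReal.measurable_ofReal,
    ← lintegral_expNeg_expMeasure hg]
  refine lintegral_congr fun x => ?_
  rw [Measure.map_apply hW (measurable_prodMk_left hlt)]
  exact hWs x.toNNReal

lemma measure_forall_lt_of_iIndepFun {ι : Type*} {T : ι → Ω → ℝ≥0∞} (hi : iIndepFun T P) {g : ι → ℝ≥0}
    (hs : ∀ u, ∀ s : ℝ≥0, P {ω | s < T u ω} = expNeg (s * g u)) (A : Finset ι) (s : ℝ≥0) :
    P {ω | s < A.inf fun u => T u ω} = expNeg (s * (∑ u ∈ A, g u : ℝ≥0)) := by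
  have h1 : {ω | s < A.inf fun u => T u ω} = ⋂ u ∈ A, T u ⁻¹' Set.Ioi (s : ℝ≥0∞) := by
    ext ω
    simp [Finset.lt_inf_iff ENNReal.coe_lt_top]
  rw [h1, hi.measure_inter_preimage_eq_mul A fun _ _ => measurableSet_Ioi, ENNReal.ofNNReal_finsetSum,
    Finset.mul_sum, expNeg_sum]
  exact Finset.prod_congr rfl fun u _ => hs u s

/-- The probability that the variable `T u` is the smallest of several independent exponential
variables is proportional to its rate. -/
theorem measure_forall_lt_eq_div {ι : Type*} [Fintype ι] {T : ι → Ω → ℝ≥0∞}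
    (hT : ∀ u, Measurable (T u)) (hi : iIndepFun T P) {g : ι → ℝ≥0}
    (hs : ∀ u, ∀ s : ℝ≥0, P {ω | s < T u ω} = expNeg (s * g u)) {u : ι} (hu : 0 < g u) :
    P {ω | T u ω < ∞ ∧ ∀ w, w ≠ u → T u ω < T w ω} = ((g u / ∑ w, g w : ℝ≥0) : ℝ≥0∞) := by
  classical
  have := hi.isProbabilityMeasure
  set A := Finset.univ.erase u with hA
  have hW : Measurable fun ω => A.inf fun w => T w ω := by
    refine measurable_of_Ioi fun c => ?_
    rcases eq_or_ne c ∞ with rfl | hc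
    · simp
    · have : (fun ω => A.inf fun w => T w ω) ⁻¹' Set.Ioi c = ⋂ w ∈ A, T w ⁻¹' Set.Ioi c := by
        ext ω
        simp [Finset.lt_inf_iff hc.lt_top]
      rw [this]
      exact Finset.measurableSet_biInter _ fun w _ => hT w measurableSet_Ioi
  have hind : IndepFun (T u) (fun ω => A.inf fun w => T w ω) P := by
    have h1 := hi.indepFun_finset {u} A (by simp [hA]) hT
    have h2 : Measurable fun x : A → ℝ≥0∞ => A.attach.inf x := by
      refine measurable_of_Ioi fun c => ?_
      rcases eq_or_ne c ∞ with rfl | hc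
      · simp
      · have : (fun x : A → ℝ≥0∞ => A.attach.inf x) ⁻¹' Set.Ioi c =
            ⋂ w ∈ A.attach, {x | c < x w} := by
          ext ω
          simp [Finset.lt_inf_iff hc.lt_top]
        rw [this]
        exact Finset.measurableSet_biInter _ fun w _ =>
          measurableSet_lt measurable_const (measurable_pi_apply w)
    have h3 := h1.comp (measurable_pi_apply (⟨u, by simp⟩ : ({u} : Finset ι))) h2
    refine h3.congr (ae_of_all _ fun ω => rfl) (ae_of_all _ fun ω => ?_)
    exact Finset.inf_attach A fun w => T w ω
  -- When there is no other index, the infimum is `∞`; this is why the event demands that `T u` be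
  -- finite.
  have hevent : {ω | T u ω < ∞ ∧ ∀ w, w ≠ u → T u ω < T w ω} =
      {ω | T u ω < A.inf fun w => T w ω} := by
    ext ω
    simp only [Set.mem_ofPred_eq]
    constructor
    · exact fun h => (Finset.lt_inf_iff h.1).2 fun w hw => h.2 w (Finset.mem_erase.1 hw).1
    · intro h
      have h1 : T u ω < ∞ := h.trans_le le_top
      exact ⟨h1, fun w hw => (Finset.lt_inf_iff h1).1 h w (by simp [hA, hw])⟩
  rw [hevent, measure_lt_of_indepFun_exponential (hT u) hW hind hu (hs u)
    (measure_forall_lt_of_iIndepFun hi hs A), hA,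
    Finset.add_sum_erase _ _ (Finset.mem_univ u)]

/-! ### Functions of disjoint blocks of independent variables -/

/-- Induction on the number of blocks: events about the remaining blocks combine into one event `B`
about their union, which is disjoint from the block `S u`. -/
lemma iIndepFun_blocks {κ ι : Type*} {f : κ → Ω → ℝ} (hf : iIndepFun f P)
    (hmeas : ∀ i, Measurable (f i)) {S : ι → Finset κ} (hS : Pairwise fun u w => Disjoint (S u) (S w)) :
    iIndepFun (fun u ω (i : S u) => f i ω) P := by
  classical
  have := hf.isProbabilityMeasure
  rw [iIndepFun_iff_measure_inter_preimage_eq_mul]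
  intro A sets hsets
  induction A using Finset.induction_on with
  | empty => simp
  | insert u A hu ih =>
    have hdisj : Disjoint (S u) (A.biUnion S) := by
      rw [Finset.disjoint_biUnion_right]
      exact fun w hw => hS fun h => hu (h ▸ hw)
    have hind := hf.indepFun_finset (S u) (A.biUnion S) hdisj hmeas
    have hsub : ∀ w ∈ A, ∀ i ∈ S w, i ∈ A.biUnion S := fun w hw i hi =>
      Finset.mem_biUnion.2 ⟨w, hw, hi⟩
    set B : Set (A.biUnion S → ℝ) :=
      ⋂ w : A, (fun (x : A.biUnion S → ℝ) (i : S w) => x ⟨i, hsub w w.2 i i.2⟩) ⁻¹' sets w with hB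
    have hBmeas : MeasurableSet B := MeasurableSet.iInter fun w =>
      (measurable_pi_lambda _ fun i => measurable_pi_apply _)
        (hsets w (Finset.mem_insert_of_mem w.2))
    have h1 := hind.measure_inter_preimage_eq_mul _ _ (hsets u (Finset.mem_insert_self u A)) hBmeas
    have h2 : (fun ω (i : A.biUnion S) => f i ω) ⁻¹' B =
        ⋂ w ∈ A, (fun ω (i : S w) => f i ω) ⁻¹' sets w := by
      ext ω
      simp [hB]
    rw [h2, ih fun w hw => hsets w (Finset.mem_insert_of_mem hw)] at h1
    rw [Finset.set_biInter_insert, Finset.prod_insert hu, h1]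

end

/-! ### Level functions -/

section Level

variable {Ω' : Type*} [MeasurableSpace Ω'] {Q : Measure Ω'} {X : ℝ≥0 → Ω' → ℝ≥0∞}

/-- In law, `X (s + r)` is `X s` plus an independent non-negative increment. Only laws are compared,
as the paths need not be monotone pointwise. -/
lemma IsNonnegLevy.measure_le_mono (hX : IsNonnegLevy Q X) (c : ℝ≥0∞) {s s' : ℝ≥0} (h : s ≤ s') :
    Q {ω | c ≤ X s ω} ≤ Q {ω | c ≤ X s' ω} := by
  have := hX.isProbabilityMeasure
  obtain ⟨r, rfl⟩ := exists_add_of_le h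
  have hprob : ∀ i : Fin 2, IsProbabilityMeasure (Q.map (X (![s, r] i))) := fun i =>
    Measure.isProbabilityMeasure_map (hX.measurable _).aemeasurable
  have h2 := hX.increments 2 ![s, r]
  have hmeas : Measurable fun (d : Fin 2 → ℝ≥0∞) (i : Fin 2) => ∑ j ∈ Finset.Iic i, d j := by
    fun_prop
  have hmeas' : Measurable fun ω (i : Fin 2) => X (∑ j ∈ Finset.Iic i, ![s, r] j) ω :=
    measurable_pi_lambda _ fun i => hX.measurable _
  have hIic0 : Finset.Iic (0 : Fin 2) = {0} := by decide
  have hIic1 : Finset.Iic (1 : Fin 2) = {0, 1} := by decide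
  have h3 : Q {ω | c ≤ X (s + r) ω} =
      (Measure.pi fun i => Q.map (X (![s, r] i))) {d | c ≤ d 0 + d 1} := by
    have hset : MeasurableSet {x : Fin 2 → ℝ≥0∞ | c ≤ x 1} :=
      measurableSet_le measurable_const (measurable_pi_apply 1)
    have h4 := congrArg (fun μ : Measure (Fin 2 → ℝ≥0∞) => μ {x | c ≤ x 1}) h2
    simp only [Measure.map_apply hmeas hset, Measure.map_apply hmeas' hset] at h4
    simpa [hIic1, Set.preimage] using h4
  have h5 : Q {ω | c ≤ X s ω} = (Measure.pi fun i => Q.map (X (![s, r] i))) {d | c ≤ d 0} := by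
    have h6 := (measurePreserving_eval (fun i : Fin 2 => Q.map (X (![s, r] i))) 0).measure_preimage
      (measurableSet_Ici (a := c)).nullMeasurableSet
    rw [Measure.map_apply (hX.measurable _) measurableSet_Ici] at h6
    exact h6.symm
  rw [h3, h5]
  exact measure_mono fun d (hd : c ≤ d 0) => hd.trans le_self_add

lemma levelFunction_mono {a a' b b' : ℝ} (ha : a ≤ a') (hb : b ≤ b') :
    levelFunction Q X a b ≤ levelFunction Q X a' b' := by
  refine le_iInf₂ fun t ht => iInf₂_le_of_le t ?_ le_rfl
  refine (ENNReal.ofReal_le_ofReal hb).trans (ht.trans (measure_mono fun ω hω => ?_))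
  exact (ENNReal.ofReal_le_ofReal ha).trans hω

lemma levelFunction_le {a b : ℝ} {t : ℝ≥0}
    (h : ENNReal.ofReal b ≤ Q {ω | ENNReal.ofReal a ≤ X t ω}) : levelFunction Q X a b ≤ t :=
  iInf₂_le t h

lemma exists_of_levelFunction_lt {a b : ℝ} {c : ℝ≥0∞} (h : levelFunction Q X a b < c) :
    ∃ t : ℝ≥0, t < c ∧ ENNReal.ofReal b ≤ Q {ω | ENNReal.ofReal a ≤ X t ω} := by
  simp only [levelFunction, iInf_lt_iff] at h
  obtain ⟨t, ht, htc⟩ := h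
  exact ⟨t, htc, ht⟩

/-- The infimum need not be attained, but some time before `t` qualifies, and then so does `t` by
monotonicity of the tail in time. -/
lemma IsNonnegLevy.le_of_levelFunction_lt (hX : IsNonnegLevy Q X) {a b : ℝ} {t : ℝ≥0}
    (h : levelFunction Q X a b < t) : ENNReal.ofReal b ≤ Q {ω | ENNReal.ofReal a ≤ X t ω} := by
  obtain ⟨s, hs, hb⟩ := exists_of_levelFunction_lt h
  exact hb.trans (hX.measure_le_mono _ (ENNReal.coe_lt_coe.1 hs).le)

lemma measurable_measure_ofReal_le (t : ℝ≥0) :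
    Measurable fun a : ℝ => Q {ω | ENNReal.ofReal a ≤ X t ω} :=
  Antitone.measurable fun _ _ h => measure_mono fun _ hω => (ENNReal.ofReal_le_ofReal h).trans hω

lemma IsNonnegLevy.measurable_levelFunction (hX : IsNonnegLevy Q X) :
    Measurable fun p : ℝ × ℝ => levelFunction Q X p.1 p.2 := by
  refine measurable_of_Iio fun c => ?_
  -- Since the admissible times are upward closed, rational times suffice and the union is
  -- countable.
  have : (fun p : ℝ × ℝ => levelFunction Q X p.1 p.2) ⁻¹' Set.Iio c =
      ⋃ (q : ℚ) (_ : (Real.toNNReal q : ℝ≥0∞) < c), {p : ℝ × ℝ |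
        ENNReal.ofReal p.2 ≤ Q {ω | ENNReal.ofReal p.1 ≤ X (Real.toNNReal q) ω}} := by
    ext p
    simp only [Set.mem_preimage, Set.mem_Iio, Set.mem_iUnion, exists_prop, Set.mem_ofPred_eq]
    constructor
    · intro h
      obtain ⟨t, ht, hp⟩ := exists_of_levelFunction_lt h
      obtain ⟨q, hq, htq, hqc⟩ := ENNReal.lt_iff_exists_rat_btwn.1 ht
      exact ⟨q, hqc, hp.trans (hX.measure_le_mono _ (ENNReal.coe_lt_coe.1 htq).le)⟩
    · rintro ⟨q, hqc, hp⟩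
      exact (levelFunction_le hp).trans_lt hqc
  rw [this]
  refine MeasurableSet.iUnion fun q => MeasurableSet.iUnion fun _ => ?_
  exact measurableSet_le (by fun_prop)
    ((measurable_measure_ofReal_le _).comp measurable_fst)

lemma IsLevyOf.lintegral_expNeg {G : ℝ≥0 → ℝ≥0} (hX : IsLevyOf G Q X) (t z : ℝ≥0) :
    ∫⁻ ω, expNeg (z * X t ω) ∂Q = expNeg (t * G z) := by
  rw [← ENNReal.coe_mul, expNeg_coe, NNReal.coe_mul]
  exact hX.laplace t z

lemma unitUniform_lt_ofReal {c : ℝ≥0∞} (hc : c ≤ 1) :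
    unitUniform {b | c < ENNReal.ofReal b} = 1 - c := by
  lift c to ℝ≥0 using (hc.trans_lt ENNReal.one_lt_top).ne
  have h1 : {b | (c : ℝ≥0∞) < ENNReal.ofReal b} = Set.Ioi (c : ℝ) := by
    ext b
    rw [Set.mem_ofPred_eq, Set.mem_Ioi, ← ENNReal.ofReal_coe_nnreal, ENNReal.ofReal_lt_ofReal_iff']
    exact ⟨fun h => h.1, fun h => ⟨h, c.coe_nonneg.trans_lt h⟩⟩
  rw [h1, unitUniform_Ioi ⟨c.coe_nonneg, by exact_mod_cast hc⟩,
    ENNReal.ofReal_sub _ c.coe_nonneg]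
  simp

variable {Ω : Type*} [MeasurableSpace Ω] {P : Measure Ω}

/-- Integrating out the uniform variable turns the probability into that of `X_s < M` under the
product of `P` and `Q`. Integrating out `M` next leaves the mean of `e^{-x X_s}`, which is the
Laplace transform of `X_s`. -/
lemma IsLevyOf.measure_lt_ofReal {G : ℝ≥0 → ℝ≥0} (hX : IsLevyOf G Q X) [IsProbabilityMeasure P]
    {M U : Ω → ℝ} (hM : Measurable M) (hU : Measurable U) (hMU : IndepFun M U P)
    (hUlaw : P.map U = unitUniform) {x : ℝ≥0} (hx : 0 < x)
    (hMs : ∀ c : ℝ≥0, P {ω | c < M ω} = expNeg (x * c)) (s : ℝ≥0) :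
    P {ω | Q {ω' | ENNReal.ofReal (M ω) ≤ X s ω'} < ENNReal.ofReal (U ω)} = expNeg (s * G x) := by
  have := hX.isNonnegLevy.isProbabilityMeasure
  have hXm := hX.isNonnegLevy.measurable s
  have hset : MeasurableSet {p : ℝ × ℝ |
      Q {ω' | ENNReal.ofReal p.1 ≤ X s ω'} < ENNReal.ofReal p.2} :=
    measurableSet_lt ((measurable_measure_ofReal_le s).comp measurable_fst) (by fun_prop)
  have h0 := Measure.map_apply (hM.prodMk hU) hset (μ := P)
  have hset2 : MeasurableSet {p : ℝ × Ω' | X s p.2 < ENNReal.ofReal p.1} :=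
    measurableSet_lt (hXm.comp measurable_snd) (by fun_prop)
  have hprob : IsProbabilityMeasure (P.map M) := Measure.isProbabilityMeasure_map hM.aemeasurable
  rw [hMU.map_prod_eq_prod_map_map hM.aemeasurable hU.aemeasurable, Measure.prod_apply hset,
    hUlaw] at h0
  have h1 : ∀ a : ℝ, unitUniform (Prod.mk a ⁻¹' {p : ℝ × ℝ |
      Q {ω' | ENNReal.ofReal p.1 ≤ X s ω'} < ENNReal.ofReal p.2}) =
      Q (Prod.mk a ⁻¹' {p : ℝ × Ω' | X s p.2 < ENNReal.ofReal p.1}) := by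
    intro a
    have h2 := unitUniform_lt_ofReal (prob_le_one (μ := Q) (s := {ω' | ENNReal.ofReal a ≤ X s ω'}))
    refine Eq.trans h2 ?_
    rw [← prob_compl_eq_one_sub (measurableSet_le measurable_const hXm)]
    congr 1
    ext ω'
    simp
  simp only [h1] at h0
  rw [← Measure.prod_apply hset2, Measure.prod_apply_symm hset2] at h0
  refine h0.symm.trans ?_
  rw [← hX.lintegral_expNeg s x]
  refine lintegral_congr fun ω' => ?_
  rw [Measure.map_apply hM (measurable_prodMk_right hset2)]
  generalize hy : X s ω' = y
  have h2 : M ⁻¹' ((fun a => (a, ω')) ⁻¹' {p : ℝ × Ω' | X s p.2 < ENNReal.ofReal p.1}) =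
      {ω | y < ENNReal.ofReal (M ω)} := by
    ext ω
    simp [hy]
  rw [h2]
  -- At `y = ∞` the event is empty, matching `e^{-x∞} = 0`, which needs `x > 0`.
  induction y with
  | top => simp [ENNReal.mul_top, hx.ne', expNeg_top]
  | coe y =>
    rw [← hMs y]
    congr 1
    ext ω
    rw [Set.mem_ofPred_eq, Set.mem_ofPred_eq, ← ENNReal.ofReal_coe_nnreal,
      ENNReal.ofReal_lt_ofReal_iff']
    exact ⟨fun h => h.1, fun h => ⟨h, y.coe_nonneg.trans_lt h⟩⟩

/-- For an exponential variable `M` of rate `x` and an independent uniform variable `U`, the level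
`ℓ(M, U)` is an exponential variable of rate `G x`. -/
theorem IsLevyOf.measure_lt_levelFunction {G : ℝ≥0 → ℝ≥0} (hX : IsLevyOf G Q X)
    [IsProbabilityMeasure P] {M U : Ω → ℝ} (hM : Measurable M) (hU : Measurable U)
    (hMU : IndepFun M U P) (hUlaw : P.map U = unitUniform) {x : ℝ≥0} (hx : 0 < x)
    (hMs : ∀ c : ℝ≥0, P {ω | c < M ω} = expNeg (x * c)) (s : ℝ≥0) :
    P {ω | s < levelFunction Q X (M ω) (U ω)} = expNeg (s * G x) := by
  have key := hX.measure_lt_ofReal hM hU hMU hUlaw hx hMs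
  refine le_antisymm ?_ ?_
  -- The event `s < ℓ` lies inside the event of `key s` and contains that of `key s'` for every `s'
  -- > s`; letting `s'` decrease to `s` closes the gap.
  · rw [← key s]
    refine measure_mono fun ω hω => ?_
    rw [Set.mem_ofPred_eq] at hω ⊢
    by_contra h
    exact absurd (levelFunction_le (not_lt.1 h)) (not_le.2 hω)
  · have h1 : ∀ s' : ℝ≥0, s < s' →
        expNeg (s' * G x) ≤ P {ω | s < levelFunction Q X (M ω) (U ω)} := by
      intro s' hs'
      rw [← key s']
      refine measure_mono fun ω hω => ?_
      rw [Set.mem_ofPred_eq] at hω ⊢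
      have h2 : (s' : ℝ≥0∞) ≤ levelFunction Q X (M ω) (U ω) := by
        by_contra h
        exact absurd (hX.isNonnegLevy.le_of_levelFunction_lt (not_le.1 h)) (not_le.2 hω)
      exact (ENNReal.coe_lt_coe.2 hs').trans_le h2
    have h2 : Tendsto (fun s' : ℝ≥0 => expNeg (s' * G x)) (𝓝[>] s) (𝓝 (expNeg (s * G x))) := by
      have hc : Continuous fun s' : ℝ≥0 => expNeg (s' * G x) := by
        have : ∀ s' : ℝ≥0, expNeg (s' * G x) = expNeg ((s' * G x : ℝ≥0) : ℝ≥0∞) := fun s' => by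
          rw [ENNReal.coe_mul]
        simp only [this]
        exact continuous_expNeg.comp (ENNReal.continuous_coe.comp (by fun_prop))
      exact (hc.tendsto s).mono_left nhdsWithin_le_nhds
    exact le_of_tendsto h2 (eventually_mem_nhdsWithin.mono h1)

end Level

/-! ### The variables of the algorithm -/

section Randomness

lemma minValue_congr {I : Finset ℕ} {a a' : ℕ → ℝ} (h : ∀ i ∈ I, a i = a' i) :
    minValue I a = minValue I a' := by
  by_cases hI : I.Nonempty
  · rw [minValue, minValue, dif_pos hI, dif_pos hI]
    exact Finset.inf'_congr hI rfl h
  · rw [minValue, minValue, dif_neg hI, dif_neg hI]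

/-- The extension of a family indexed by a finite set of updates. -/
def extendValues {n : ℕ} (S : Finset (ℕ ⊕ Fin n)) (z : S → ℝ) (i : ℕ ⊕ Fin n) : ℝ :=
  open Classical in if h : i ∈ S then z ⟨i, h⟩ else 0

lemma measurable_extendValues {n : ℕ} (S : Finset (ℕ ⊕ Fin n)) (i : ℕ ⊕ Fin n) :
    Measurable fun z => extendValues S z i := by
  unfold extendValues
  split_ifs
  · exact measurable_pi_apply _
  · exact measurable_const

lemma extendValues_apply {n : ℕ} {S : Finset (ℕ ⊕ Fin n)} {f : ℕ ⊕ Fin n → ℝ} {i : ℕ ⊕ Fin n}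
    (h : i ∈ S) : extendValues S (fun j : S => f j) i = f i := by
  simp [extendValues, h]

lemma measurable_minValue_extendValues {n : ℕ} (Δ : ℕ → ℝ≥0) (I : Finset ℕ)
    (S : Finset (ℕ ⊕ Fin n)) :
    Measurable fun z : S → ℝ => minValue I fun i => extendValues S z (Sum.inl i) / Δ i :=
  (ParetoSampling.measurable_minValue I).comp
    (measurable_pi_lambda _ fun i => (measurable_extendValues S (Sum.inl i)).div_const _)

/-- This exhibits a minimum over updates as a function of a finite block of the random variables,
the form in which independence of blocks applies. -/
lemma minValue_extendValues {n : ℕ} {I : Finset ℕ} {S : Finset (ℕ ⊕ Fin n)} (hI : ∀ i ∈ I, Sum.inl i ∈ S)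
    (Δ : ℕ → ℝ≥0) (f : ℕ ⊕ Fin n → ℝ) :
    (minValue I fun i => extendValues S (fun j : S => f j) (Sum.inl i) / Δ i) =
      minValue I fun i => f (Sum.inl i) / Δ i := by
  refine minValue_congr fun i hi => ?_
  rw [extendValues_apply (hI i hi)]

variable {Ω : Type*} [MeasurableSpace Ω] {n : ℕ} {P : Measure Ω} {Y : ℕ → Ω → ℝ} {H : Fin n → Ω → ℝ}

lemma IsRandomness.measurable_elim (hR : IsRandomness P Y H) (i : ℕ ⊕ Fin n) :
    Measurable (Sum.elim Y H i) := by
  cases i with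
  | inl i => exact hR.measurable_Y i
  | inr u => exact hR.measurable_H u

lemma IsRandomness.measurable_minValue (hR : IsRandomness P Y H) (Δ : ℕ → ℝ≥0) (I : Finset ℕ) :
    Measurable fun ω => minValue I fun i => Y i ω / Δ i :=
  (ParetoSampling.measurable_minValue I).comp
    (measurable_pi_lambda _ fun i => (hR.measurable_Y i).div_const _)

/-- Each `Y i / Δ i` is exponential of rate `Δ i`, and rates add up under minima of independent
variables. -/
lemma IsRandomness.measure_lt_minValue (hR : IsRandomness P Y H) {Δ : ℕ → ℝ≥0} (hΔ : ∀ i, 0 < Δ i)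
    {I : Finset ℕ} (hI : I.Nonempty) (c : ℝ≥0) :
    P {ω | c < minValue I fun i => Y i ω / Δ i} = expNeg ((∑ i ∈ I, Δ i : ℝ≥0) * c) := by
  have hindep : iIndepFun Y P := iIndepFun.precomp (g := Sum.inl) Sum.inl_injective hR.indep
  have h1 : {ω | (c : ℝ) < minValue I fun i => Y i ω / Δ i} =
      ⋂ i ∈ I, Y i ⁻¹' Set.Ioi (c * Δ i : ℝ) := by
    ext ω
    simp only [Set.mem_ofPred_eq, lt_minValue_iff hI, Set.mem_iInter, Set.mem_preimage, Set.mem_Ioi]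
    refine forall₂_congr fun i _ => ?_
    rw [lt_div_iff₀ (by exact_mod_cast hΔ i)]
  rw [h1, hindep.measure_inter_preimage_eq_mul I fun _ _ => measurableSet_Ioi,
    ENNReal.ofNNReal_finsetSum, Finset.sum_mul, expNeg_sum]
  refine Finset.prod_congr rfl fun i _ => ?_
  rw [← Measure.map_apply (hR.measurable_Y i) measurableSet_Ioi, hR.law_Y,
    expMeasure_Ioi one_pos (by positivity), ← ENNReal.coe_mul, expNeg_coe]
  congr 3
  push_cast
  ring

lemma IsRandomness.indepFun_minValue_hash (hR : IsRandomness P Y H) (Δ : ℕ → ℝ≥0) (I : Finset ℕ)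
    (u : Fin n) : IndepFun (fun ω => minValue I fun i => Y i ω / Δ i) (H u) P := by
  have h1 := hR.indep.indepFun_finset (I.map Function.Embedding.inl) {Sum.inr u}
    (by simp) hR.measurable_elim
  have h2 := h1.comp (measurable_minValue_extendValues Δ I _)
    (measurable_pi_apply (⟨Sum.inr u, by simp⟩ : ({Sum.inr u} : Finset (ℕ ⊕ Fin n))))
  refine h2.congr (ae_of_all _ fun ω => ?_) (ae_of_all _ fun ω => rfl)
  exact minValue_extendValues (fun i hi => by simpa using hi) Δ fun j => Sum.elim Y H j ω

/-- The vector of the smallest values and the hash function are independent. -/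
lemma IsRandomness.indepFun_minValues_hashes (hR : IsRandomness P Y H) (Δ : ℕ → ℝ≥0) (t : ℕ)
    (v : ℕ → Fin n) :
    IndepFun (fun ω u => minValue (updates v t u) fun i => Y i ω / Δ i) (fun ω u => H u ω) P := by
  have h1 := hR.indep.indepFun_finset ((Finset.range t).map Function.Embedding.inl)
    (Finset.univ.map Function.Embedding.inr) (by simp [Finset.disjoint_left]) hR.measurable_elim
  have h2 := h1.comp
    (measurable_pi_lambda _ fun u => measurable_minValue_extendValues Δ (updates v t u) _)
    (measurable_pi_lambda _ fun u : Fin n => measurable_extendValues _ (Sum.inr u))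
  refine h2.congr (ae_of_all _ fun ω => ?_) (ae_of_all _ fun ω => ?_)
  · funext u
    exact minValue_extendValues (fun i hi => by simpa using (mem_updates.1 hi).1) Δ
      fun j => Sum.elim Y H j ω
  · funext u
    exact extendValues_apply (f := fun j => Sum.elim Y H j ω) (by simp)

open Classical in
/-- The level of the coordinate `u` after `t` updates (infinite if `u` has not been updated). -/
def level (l : ℝ → ℝ → ℝ≥0∞) (v : ℕ → Fin n) (Δ : ℕ → ℝ≥0) (t : ℕ) (u : Fin n) (y : ℕ → ℝ)
    (b : ℝ) : ℝ≥0∞ :=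
  if (updates v t u).Nonempty then l (minValue (updates v t u) fun i => y i / Δ i) b else ∞

lemma measurable_level {l : ℝ → ℝ → ℝ≥0∞} (hl : Measurable fun p : ℝ × ℝ => l p.1 p.2)
    (v : ℕ → Fin n) (Δ : ℕ → ℝ≥0) (t : ℕ) (u : Fin n) {α : Type*} [MeasurableSpace α]
    {y : α → ℕ → ℝ} {b : α → ℝ}
    (hy : Measurable fun z => minValue (updates v t u) fun i => y z i / Δ i) (hb : Measurable b) :
    Measurable fun z => level l v Δ t u (y z) (b z) := by
  unfold level
  split_ifs
  · exact hl.comp (hy.prodMk hb)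
  · exact measurable_const

/-- The level of `u` depends only on its hash and on the exponential variables of its own updates.
These blocks are disjoint, as every update concerns a single coordinate. -/
lemma IsRandomness.iIndepFun_level (hR : IsRandomness P Y H) {l : ℝ → ℝ → ℝ≥0∞}
    (hl : Measurable fun p : ℝ × ℝ => l p.1 p.2) (v : ℕ → Fin n) (Δ : ℕ → ℝ≥0) (t : ℕ) :
    iIndepFun (fun u ω => level l v Δ t u (fun i => Y i ω) (H u ω)) P := by
  classical
  set S : Fin n → Finset (ℕ ⊕ Fin n) := fun u =>
    insert (Sum.inr u) ((updates v t u).map Function.Embedding.inl) with hS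
  have hdisj : Pairwise fun u w => Disjoint (S u) (S w) := by
    intro u w huw
    rw [Finset.disjoint_left]
    rintro (i | i) hi hi'
    · simp only [hS, Finset.mem_insert, reduceCtorEq, Finset.mem_map,
        Function.Embedding.inl_apply, Sum.inl.injEq, exists_eq_right, false_or] at hi hi'
      exact huw ((mem_updates.1 hi).2.symm.trans (mem_updates.1 hi').2)
    · simp only [hS, Finset.mem_insert, Sum.inr.injEq, Finset.mem_map,
        Function.Embedding.inl_apply, reduceCtorEq, and_false, exists_false, or_false] at hi hi'
      exact huw (hi.symm.trans hi')
  have h1 := (iIndepFun_blocks hR.indep hR.measurable_elim hdisj).comp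
    (fun u z => level l v Δ t u (fun i => extendValues (S u) z (Sum.inl i))
      (extendValues (S u) z (Sum.inr u)))
    fun u => measurable_level hl v Δ t u (measurable_minValue_extendValues Δ _ _)
      (measurable_extendValues _ _)
  refine h1.congr fun u => ae_of_all _ fun ω => ?_
  simp only [Function.comp, level]
  rw [minValue_extendValues (fun i hi => by simpa [hS] using hi) Δ fun j => Sum.elim Y H j ω,
    extendValues_apply (f := fun j => Sum.elim Y H j ω) (by simp [hS])]
  rfl

/-- Almost surely, the values generated by the updates are distinct. -/
lemma IsRandomness.ae_injective (hR : IsRandomness P Y H) {Δ : ℕ → ℝ≥0} (hΔ : ∀ i, 0 < Δ i) :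
    ∀ᵐ ω ∂P, Function.Injective fun i => Y i ω / (Δ i : ℝ) := by
  have := hR.isProbabilityMeasure
  have hindep : iIndepFun Y P := iIndepFun.precomp (g := Sum.inl) Sum.inl_injective hR.indep
  have h1 : ∀ i j, i ≠ j → ∀ᵐ ω ∂P, Y i ω / (Δ i : ℝ) ≠ Y j ω / Δ j := by
    intro i j hij
    have hset : MeasurableSet {p : ℝ × ℝ | p.1 / (Δ i : ℝ) = p.2 / Δ j} :=
      measurableSet_eq_fun (by fun_prop) (by fun_prop)
    have h2 := Measure.map_apply ((hR.measurable_Y i).prodMk (hR.measurable_Y j)) hset (μ := P)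
    have hpr := isProbabilityMeasure_expMeasure one_pos
    rw [(hindep.indepFun hij).map_prod_eq_prod_map_map (hR.measurable_Y i).aemeasurable
      (hR.measurable_Y j).aemeasurable, hR.law_Y, hR.law_Y, Measure.prod_apply hset] at h2
    -- Given the first value, a tie fixes the second variable to a single point, which is null for
    -- an absolutely continuous law.
    have h3 : ∀ x : ℝ, expMeasure 1 (Prod.mk x ⁻¹' {p : ℝ × ℝ | p.1 / (Δ i : ℝ) = p.2 / Δ j}) = 0 := by
      intro x
      have hs : Prod.mk x ⁻¹' {p : ℝ × ℝ | p.1 / (Δ i : ℝ) = p.2 / Δ j} ⊆ {x / Δ i * Δ j} := by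
        intro y (hy : x / (Δ i : ℝ) = y / Δ j)
        rw [Set.mem_singleton_iff, hy, div_mul_cancel₀]
        exact_mod_cast (hΔ j).ne'
      refine measure_mono_null hs ?_
      have hac : expMeasure 1 ≪ volume := withDensity_absolutelyContinuous _ _
      exact hac (measure_singleton _)
    simp only [h3, lintegral_zero] at h2
    rw [ae_iff]
    simpa using h2.symm
  have h2 : ∀ᵐ ω ∂P, ∀ i j, i ≠ j → Y i ω / (Δ i : ℝ) ≠ Y j ω / Δ j := by
    rw [ae_all_iff]
    intro i
    rw [ae_all_iff]
    intro j
    by_cases hij : i = j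
    · simp [hij]
    · filter_upwards [h1 i j hij] with ω hω _ using hω
  filter_upwards [h2] with ω hω i j hij
  by_contra hne
  exact hω i j hne hij

end Randomness

section

variable {Ω : Type*} [MeasurableSpace Ω] {n : ℕ} {P : Measure Ω} {Y : ℕ → Ω → ℝ} {H : Fin n → Ω → ℝ}

/-! ### The size of the state -/

/-- The coordinates that have been updated before time `t`. -/
def support (v : ℕ → Fin n) (Δ : ℕ → ℝ≥0) (t : ℕ) : Finset (Fin n) :=
  Finset.univ.filter fun u => 0 < vec v Δ t u

lemma mem_support {v : ℕ → Fin n} {Δ : ℕ → ℝ≥0} (hΔ : ∀ i, 0 < Δ i) {t : ℕ} {u : Fin n} :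
    u ∈ support v Δ t ↔ (updates v t u).Nonempty := by
  simp [support, vec_pos_iff hΔ]

/-- The size of the state, as a function of the smallest values and of the hash function. -/
def stateSize (v : ℕ → Fin n) (Δ : ℕ → ℝ≥0) (Y : ℕ → Ω → ℝ) (H : Fin n → Ω → ℝ) (t : ℕ) (ω : Ω) : ℕ :=
  (records (support v Δ t) (fun u => minValue (updates v t u) fun i => Y i ω / Δ i)
    fun u => H u ω).card

lemma IsRandomness.measurable_minValues (hR : IsRandomness P Y H) (v : ℕ → Fin n) (Δ : ℕ → ℝ≥0)
    (t : ℕ) : Measurable fun ω u => minValue (updates v t u) fun i => Y i ω / Δ i :=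
  measurable_pi_lambda _ fun _ => hR.measurable_minValue Δ _

lemma IsRandomness.measurable_stateSize (hR : IsRandomness P Y H) (v : ℕ → Fin n) (Δ : ℕ → ℝ≥0)
    (t : ℕ) : Measurable (stateSize v Δ Y H t) := by
  have h1 : Measurable fun ω => ((fun u => minValue (updates v t u) fun i => Y i ω / Δ i),
      fun u => H u ω) :=
    (hR.measurable_minValues v Δ t).prodMk (measurable_pi_lambda _ hR.measurable_H)
  have h2 := (measurable_card_records (support v Δ t)).comp h1
  unfold stateSize
  simpa only [Function.comp_def] using h2

/-- This replaces the size of the state by the measurable function `stateSize`, off the null event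
of tied values. -/
lemma IsRandomness.card_state_ae_eq (hR : IsRandomness P Y H) {Δ : ℕ → ℝ≥0} (hΔ : ∀ i, 0 < Δ i)
    (v : ℕ → Fin n) (t : ℕ) :
    (fun ω => (state v Δ (fun i => Y i ω) (fun u => H u ω) t).card) =ᵐ[P] stateSize v Δ Y H t := by
  filter_upwards [hR.ae_injective hΔ] with ω hω
  rw [state_eq_pareto_tuples]
  exact card_pareto_tuples hω _ t fun u => mem_support hΔ

lemma IsRandomness.map_hash (hR : IsRandomness P Y H) :
    P.map (fun ω u => H u ω) = Measure.pi fun _ => unitUniform := by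
  have hindep : iIndepFun H P := iIndepFun.precomp (g := Sum.inr) Sum.inr_injective hR.indep
  rw [hindep.map_fun_eq_pi_map fun u => (hR.measurable_H u).aemeasurable]
  congr 1
  funext u
  exact hR.law_H u

/-- Condition on the smallest values, which are independent of the hashes: the integral over the
hashes is the same constant for almost every order of the coordinates. -/
lemma IsRandomness.lintegral_stateSize (hR : IsRandomness P Y H) {Δ : ℕ → ℝ≥0} (hΔ : ∀ i, 0 < Δ i)
    (v : ℕ → Fin n) (t : ℕ) (f : ℕ → ℝ≥0∞) (c : ℝ≥0∞)
    (hf : ∀ m : Fin n → ℝ, Set.InjOn m (support v Δ t) →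
      ∫⁻ h, f (records (support v Δ t) m h).card ∂Measure.pi (fun _ => unitUniform) = c) :
    ∫⁻ ω, f (stateSize v Δ Y H t ω) ∂P = c := by
  have := hR.isProbabilityMeasure
  have hM := hR.measurable_minValues v Δ t
  have hH : Measurable fun ω u => H u ω := measurable_pi_lambda _ hR.measurable_H
  have hF : Measurable fun p : (Fin n → ℝ) × (Fin n → ℝ) =>
      f (records (support v Δ t) p.1 p.2).card :=
    measurable_from_nat.comp (measurable_card_records (support v Δ t))
  have h1 := lintegral_map hF (hM.prodMk hH) (μ := P)
  have hG : Measurable fun m => ∫⁻ h, f (records (support v Δ t) m h).card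
      ∂Measure.pi (fun _ : Fin n => unitUniform) := hF.lintegral_prod_right'
  rw [(hR.indepFun_minValues_hashes Δ t v).map_prod_eq_prod_map_map hM.aemeasurable
    hH.aemeasurable, lintegral_prod _ hF.aemeasurable, hR.map_hash, lintegral_map hG hM] at h1
  refine h1.symm.trans ?_
  have h2 : ∀ᵐ ω ∂P, ∫⁻ h, f (records (support v Δ t)
      (fun u => minValue (updates v t u) fun i => Y i ω / Δ i) h).card
      ∂Measure.pi (fun _ : Fin n => unitUniform) = c := by
    filter_upwards [hR.ae_injective hΔ] with ω hω
    refine hf _ fun u hu w hw huw => ?_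
    exact minValue_injOn hω ((mem_support hΔ).1 hu) ((mem_support hΔ).1 hw) huw
  rw [lintegral_congr_ae h2]
  simp

/-- The expected size of the state is a harmonic number. -/
theorem IsRandomness.integral_card_state (hR : IsRandomness P Y H) {Δ : ℕ → ℝ≥0}
    (hΔ : ∀ i, 0 < Δ i) (v : ℕ → Fin n) (t : ℕ) :
    Integrable (fun ω => ((state v Δ (fun i => Y i ω) (fun u => H u ω) t).card : ℝ)) P ∧
    ∫ ω, ((state v Δ (fun i => Y i ω) (fun u => H u ω) t).card : ℝ) ∂P =
      ((harmonic (support v Δ t).card : ℚ) : ℝ) := by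
  have hae : (fun ω => ((state v Δ (fun i => Y i ω) (fun u => H u ω) t).card : ℝ)) =ᵐ[P]
      fun ω => (stateSize v Δ Y H t ω : ℝ) :=
    (hR.card_state_ae_eq hΔ v t).mono fun ω hω => congrArg (Nat.cast : ℕ → ℝ) hω
  have hmeas : Measurable fun ω => (stateSize v Δ Y H t ω : ℝ) :=
    measurable_from_nat.comp (hR.measurable_stateSize v Δ t)
  have hint : ∫⁻ ω, ENNReal.ofReal (stateSize v Δ Y H t ω) ∂P =
      ENNReal.ofReal ((harmonic (support v Δ t).card : ℚ) : ℝ) := by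
    simp only [ENNReal.ofReal_natCast]
    exact hR.lintegral_stateSize hΔ v t (fun j => j) _ fun m hm => lintegral_card_records _ m hm
  constructor
  · rw [integrable_congr hae]
    refine ⟨hmeas.aestronglyMeasurable, ?_⟩
    rw [hasFiniteIntegral_iff_ofReal (ae_of_all _ fun ω => Nat.cast_nonneg _), hint]
    exact ENNReal.ofReal_lt_top
  · rw [integral_congr_ae hae, integral_eq_lintegral_of_nonneg_ae
      (ae_of_all _ fun ω => Nat.cast_nonneg _) hmeas.aestronglyMeasurable, hint,
      ENNReal.toReal_ofReal]
    exact_mod_cast Finset.sum_nonneg fun i _ => by positivity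

/-- Markov's inequality for `2 ^ |S|`, whose mean is one more than the number of updated
coordinates, hence at most `n + 1`. -/
lemma IsRandomness.measure_le_two_pow_card_state (hR : IsRandomness P Y H) {Δ : ℕ → ℝ≥0}
    (hΔ : ∀ i, 0 < Δ i) (v : ℕ → Fin n) (t : ℕ) {K : ℕ} (hK : K ≠ 0) :
    P {ω | K ≤ 2 ^ (state v Δ (fun i => Y i ω) (fun u => H u ω) t).card} ≤
      ((n + 1 : ℕ) : ℝ≥0∞) / K := by
  have hmeas : Measurable fun ω => (2 : ℝ≥0∞) ^ stateSize v Δ Y H t ω :=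
    (measurable_from_nat (f := fun j : ℕ => (2 : ℝ≥0∞) ^ j)).comp (hR.measurable_stateSize v Δ t)
  have h1 := meas_ge_le_lintegral_div (μ := P) hmeas.aemeasurable (ε := K) (by exact_mod_cast hK)
    (ENNReal.natCast_ne_top K)
  rw [hR.lintegral_stateSize hΔ v t (fun j => 2 ^ j) _ fun m hm =>
    lintegral_two_pow_card_records _ m hm] at h1
  have h2 : P {ω | K ≤ 2 ^ (state v Δ (fun i => Y i ω) (fun u => H u ω) t).card} =
      P {ω | (K : ℝ≥0∞) ≤ 2 ^ stateSize v Δ Y H t ω} := by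
    refine measure_congr ?_
    filter_upwards [hR.card_state_ae_eq hΔ v t] with ω hω
    refine propext ?_
    change K ≤ 2 ^ (state v Δ (fun i => Y i ω) (fun u => H u ω) t).card ↔
      (K : ℝ≥0∞) ≤ 2 ^ stateSize v Δ Y H t ω
    rw [← hω]
    norm_cast
  rw [h2]
  refine h1.trans (ENNReal.div_le_div_right ?_ _)
  push_cast
  gcongr
  exact (Finset.card_le_univ _).trans_eq (Fintype.card_fin n)

lemma update_count_bound {A k d n m : ℕ} (hn : 2 ≤ n) (hm : m ≤ A * n ^ k) :
    (m + 1) * (n + 1) * n ^ d ≤ n ^ (k + A + 2 + d) := by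
  have h1 : m + 1 ≤ n ^ (k + A) := by
    calc m + 1 ≤ A * n ^ k + n ^ k := add_le_add hm (Nat.one_le_pow _ _ (by omega))
      _ = (A + 1) * n ^ k := by ring
      _ ≤ n ^ A * n ^ k := Nat.mul_le_mul_right _ (Nat.succ_le_of_lt (Nat.lt_pow_self hn))
      _ = n ^ (k + A) := by ring
  have h2 : n + 1 ≤ n ^ 2 := by nlinarith
  calc (m + 1) * (n + 1) * n ^ d ≤ n ^ (k + A) * n ^ 2 * n ^ d := by gcongr
    _ = n ^ (k + A + 2 + d) := by ring

/-- With high probability, the state stays small during polynomially many updates. -/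
theorem IsRandomness.measure_exists_words_gt (hR : IsRandomness P Y H) {Δ : ℕ → ℝ≥0}
    (hΔ : ∀ i, 0 < Δ i) (v : ℕ → Fin n) {A k d m : ℕ} (hm : m ≤ A * n ^ k) :
    P {ω | ∃ t ≤ m, 3 * (k + A + 2 + d : ℕ) / Real.log 2 * Real.log n <
      (words (state v Δ (fun i => Y i ω) (fun u => H u ω) t) : ℝ)} ≤
      ENNReal.ofReal (1 / (n : ℝ) ^ d) := by
  have := hR.isProbabilityMeasure
  -- The existence of `v 0` excludes `n = 0`, and for `n = 1` the bound on the probability is `1`.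
  have hn0 : 0 < n := (v 0).pos
  rcases (Nat.succ_le_of_lt hn0).eq_or_lt with rfl | hn
  · simpa using prob_le_one
  have hn2 : 2 ≤ n := hn
  -- With three words per tuple, exceeding the threshold forces `2 ^ |S| > n ^ D`. Of the exponent,
  -- `k + A` pays for the `m + 1` times, `2` for the factor `n + 1`, and `d` for the final bound.
  set D := k + A + 2 + d with hD
  have hKne : n ^ D ≠ 0 := pow_ne_zero _ (by omega)
  have hsub : {ω | ∃ t ≤ m, 3 * (D : ℕ) / Real.log 2 * Real.log n <
      (words (state v Δ (fun i => Y i ω) (fun u => H u ω) t) : ℝ)} ⊆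
      ⋃ t ∈ Finset.range (m + 1),
        {ω | n ^ D ≤ 2 ^ (state v Δ (fun i => Y i ω) (fun u => H u ω) t).card} := by
    rintro ω ⟨t, ht, hlt⟩
    refine Set.mem_biUnion (x := t) (by simpa [Nat.lt_succ_iff] using ht) ?_
    rw [Set.mem_ofPred_eq]
    set s := (state v Δ (fun i => Y i ω) (fun u => H u ω) t).card with hs
    have hlog2 : 0 < Real.log 2 := Real.log_pos one_lt_two
    have h1 : (D : ℝ) * Real.log n < s * Real.log 2 := by
      rw [words, ← hs, div_mul_eq_mul_div, div_lt_iff₀ hlog2] at hlt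
      push_cast at hlt
      linarith
    rw [← Real.log_pow, ← Real.log_pow] at h1
    have h2 : ((n : ℝ) ^ D) < 2 ^ s := (Real.log_lt_log_iff (by positivity) (by positivity)).1 h1
    exact_mod_cast h2.le
  refine (measure_mono hsub).trans ((measure_biUnion_finset_le _ _).trans ?_)
  refine (Finset.sum_le_sum fun t _ =>
    hR.measure_le_two_pow_card_state hΔ v t hKne).trans ?_
  rw [Finset.sum_const, Finset.card_range, nsmul_eq_mul, one_div,
    ENNReal.ofReal_inv_of_pos (by positivity), ENNReal.ofReal_pow (by positivity),
    ENNReal.ofReal_natCast, ← mul_div_assoc]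
  have hpow : ((n : ℝ≥0∞) ^ d) ≠ 0 := pow_ne_zero _ (by exact_mod_cast hn0.ne')
  refine ENNReal.div_le_of_le_mul ?_
  rw [mul_comm (((n : ℝ≥0∞) ^ d)⁻¹), ← div_eq_mul_inv, ENNReal.le_div_iff_mul_le (Or.inl hpow) (Or.inl (by finiteness))]
  exact_mod_cast update_count_bound hn2 hm

/-! ### The law of the sample -/

lemma map_zero_of_mem_classG {G : ℝ≥0 → ℝ≥0} (hG : G ∈ classG) : G 0 = 0 := by
  obtain ⟨c, γ, ν, -, h⟩ := hG
  have := h 0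
  simpa using this

section Sample

variable {Ω' : Type*} [MeasurableSpace Ω'] {Q : Measure Ω'} {X : ℝ≥0 → Ω' → ℝ≥0∞}

/-- A coordinate without updates fits the same formula: its level is infinite and its rate is `G 0 =
0`. -/
lemma IsRandomness.measure_lt_level (hR : IsRandomness P Y H) {Δ : ℕ → ℝ≥0} (hΔ : ∀ i, 0 < Δ i)
    (v : ℕ → Fin n) (t : ℕ) {G : ℝ≥0 → ℝ≥0} (hG : G 0 = 0) (hX : IsLevyOf G Q X) (u : Fin n)
    (s : ℝ≥0) :
    P {ω | s < level (levelFunction Q X) v Δ t u (fun i => Y i ω) (H u ω)} =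
      expNeg (s * G (vec v Δ t u)) := by
  have := hR.isProbabilityMeasure
  by_cases hu : (updates v t u).Nonempty
  · simp only [level, if_pos hu]
    refine hX.measure_lt_levelFunction (hR.measurable_minValue Δ _) (hR.measurable_H u)
      (hR.indepFun_minValue_hash Δ _ u) (hR.law_H u) ((vec_pos_iff hΔ).2 hu) (fun c => ?_) s
    rw [vec_eq_sum_updates]
    exact hR.measure_lt_minValue hΔ hu c
  · have h0 : vec v Δ t u = 0 := by
      by_contra h
      exact hu ((vec_pos_iff hΔ).1 (pos_iff_ne_zero.2 h))
    simp [level, hu, h0, hG, expNeg_zero]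

/-- The query returns every coordinate with probability proportional to its contribution to the
`G`-moment. -/
theorem IsRandomness.measure_sample_eq (hR : IsRandomness P Y H) {Δ : ℕ → ℝ≥0} (hΔ : ∀ i, 0 < Δ i)
    (v : ℕ → Fin n) (t : ℕ) {G : ℝ≥0 → ℝ≥0} (hG : G 0 = 0) (hpos : 0 < moment G (vec v Δ t))
    (hX : IsLevyOf G Q X) (u : Fin n) :
    P {ω | sample (levelFunction Q X) (state v Δ (fun i => Y i ω) (fun u => H u ω) t) = some u} =
      ((G (vec v Δ t u) / moment G (vec v Δ t) : ℝ≥0) : ℝ≥0∞) := by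
  classical
  have := hR.isProbabilityMeasure
  set T : Fin n → Ω → ℝ≥0∞ := fun u ω =>
    level (levelFunction Q X) v Δ t u (fun i => Y i ω) (H u ω) with hT
  have hlm := hX.isNonnegLevy.measurable_levelFunction
  have hTm : ∀ u, Measurable (T u) := fun u =>
    measurable_level hlm v Δ t u (hR.measurable_minValue Δ _) (hR.measurable_H u)
  set E : Fin n → Set Ω := fun u => {ω | T u ω < ∞ ∧ ∀ w, w ≠ u → T u ω < T w ω} with hE
  have hEm : ∀ u, MeasurableSet (E u) := by
    intro u
    refine MeasurableSet.inter (s₁ := {ω | T u ω < ∞}) (s₂ := {ω | ∀ w, w ≠ u → T u ω < T w ω})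
      (measurableSet_lt (hTm u) measurable_const) ?_
    simp only [Set.ofPred_forall]
    exact MeasurableSet.iInter fun w => MeasurableSet.iInter fun _ => measurableSet_lt (hTm u) (hTm w)
  have hEdisj : Pairwise fun u w => Disjoint (E u) (E w) := by
    intro u w huw
    rw [Set.disjoint_left]
    exact fun ω hω hω' => absurd (hω.2 w huw.symm) (hω'.2 u huw).not_gt
  have hsample : ∀ u, ∀ ω ∈ E u,
      sample (levelFunction Q X) (state v Δ (fun i => Y i ω) (fun u => H u ω) t) = some u := by
    intro u ω hω
    have hu : (updates v t u).Nonempty := by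
      by_contra h
      have h1 := hω.1
      simp [hT, level, h] at h1
    rw [state_eq_pareto_tuples]
    refine sample_pareto_tuples (fun a a' b b' ha hb => levelFunction_mono ha hb) hu
      fun w hw hwne => ?_
    have h1 := hω.2 w hw
    simpa only [hT, level, if_pos hu, if_pos hwne] using h1
  have hlow : ∀ w, ((G (vec v Δ t w) / moment G (vec v Δ t) : ℝ≥0) : ℝ≥0∞) ≤ P (E w) := by
    intro w
    rcases eq_or_ne (G (vec v Δ t w)) 0 with h0 | h0
    · simp [h0]
    · exact (measure_forall_lt_eq_div hTm (hR.iIndepFun_level hlm v Δ t)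
        (fun u s => hR.measure_lt_level hΔ v t hG hX u s) (pos_iff_ne_zero.2 h0)).ge
  -- The lower bounds for all coordinates sum to `1`, and the event that `u` is returned avoids `E
  -- w` for `w ≠ u`, so its own lower bound is sharp. Only the events `E w` need to be measurable
  -- here.
  refine le_antisymm ?_ ((hlow u).trans (measure_mono (hsample u)))
  set A := {ω | sample (levelFunction Q X)
    (state v Δ (fun i => Y i ω) (fun u => H u ω) t) = some u} with hA
  have hB : MeasurableSet (⋃ w ∈ Finset.univ.erase u, E w) :=
    Finset.measurableSet_biUnion _ fun w _ => hEm w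
  have hdisj : Disjoint A (⋃ w ∈ Finset.univ.erase u, E w) := by
    rw [Set.disjoint_left]
    intro ω hω hω'
    simp only [Set.mem_iUnion] at hω'
    obtain ⟨w, hw, hωw⟩ := hω'
    have h1 := (hsample w ω hωw).symm.trans hω
    exact (Finset.mem_erase.1 hw).1 (Option.some.inj h1)
  have h1 : P A + ∑ w ∈ Finset.univ.erase u,
      ((G (vec v Δ t w) / moment G (vec v Δ t) : ℝ≥0) : ℝ≥0∞) ≤ 1 := by
    calc P A + ∑ w ∈ Finset.univ.erase u,
          ((G (vec v Δ t w) / moment G (vec v Δ t) : ℝ≥0) : ℝ≥0∞)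
        ≤ P A + ∑ w ∈ Finset.univ.erase u, P (E w) := by
          gcongr with w
          exact hlow w
      _ = P (A ∪ ⋃ w ∈ Finset.univ.erase u, E w) := by
          rw [measure_union hdisj hB, measure_biUnion_finset (fun a _ b _ hab => hEdisj hab)
            fun w _ => hEm w]
      _ ≤ 1 := prob_le_one
  have h2 : ((G (vec v Δ t u) / moment G (vec v Δ t) : ℝ≥0) : ℝ≥0∞) + ∑ w ∈ Finset.univ.erase u,
      ((G (vec v Δ t w) / moment G (vec v Δ t) : ℝ≥0) : ℝ≥0∞) = 1 := by
    rw [Finset.add_sum_erase _ (fun w => ((G (vec v Δ t w) / moment G (vec v Δ t) : ℝ≥0) : ℝ≥0∞))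
      (Finset.mem_univ u), ← ENNReal.ofNNReal_finsetSum, ← Finset.sum_div]
    have : (∑ w, G (vec v Δ t w)) = moment G (vec v Δ t) := rfl
    rw [this, div_self hpos.ne', ENNReal.coe_one]
  refine ENNReal.le_of_add_le_add_right (a := ∑ w ∈ Finset.univ.erase u,
      ((G (vec v Δ t w) / moment G (vec v Δ t) : ℝ≥0) : ℝ≥0∞)) ?_ (h1.trans_eq h2.symm)
  exact ENNReal.sum_ne_top.2 fun w _ => ENNReal.coe_ne_top

end Sample

end

/-! ### Uniqueness of Laplace transforms on `[0,∞]^k` -/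

section Laplace

/-- The functions `x ↦ e^{-x i}` on `[0,∞]^κ`. -/
def expNegCoord {κ : Type*} (i : κ) : BoundedContinuousFunction (κ → ℝ≥0∞) ℝ :=
  BoundedContinuousFunction.mkOfCompact
    ⟨fun x => (expNeg (x i)).toReal, by
      refine continuous_iff_continuousAt.2 fun x => ?_
      exact (ENNReal.tendsto_toReal (expNeg_ne_top _)).comp
        ((continuous_expNeg.comp (continuous_apply i)).continuousAt)⟩

lemma expNegCoord_apply {κ : Type*} (i : κ) (x : κ → ℝ≥0∞) : expNegCoord i x = (expNeg (x i)).toReal := rfl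

/-- The algebra generated by the functions `x ↦ e^{-x i}` on `[0,∞]^κ`. -/
def laplaceAlgebra (κ : Type*) [Fintype κ] :
    StarSubalgebra ℝ (BoundedContinuousFunction (κ → ℝ≥0∞) ℝ) where
  toSubalgebra := Algebra.adjoin ℝ (Set.range expNegCoord)
  star_mem' := by
    intro g hg
    have : star g = g := by
      ext x
      simp
    rwa [this]

/-- Products of exponentials of coordinates are exponentials of linear forms, so integrating them
gives values of the Laplace transform. -/
lemma exists_eq_of_mem_closure {κ : Type*} [Fintype κ]
    {g : BoundedContinuousFunction (κ → ℝ≥0∞) ℝ}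
    (hg : g ∈ Submonoid.closure (Set.range (expNegCoord (κ := κ)))) :
    ∃ z : κ → ℝ≥0, ∀ x, g x = (expNeg (∑ i, z i * x i)).toReal := by
  classical
  induction hg using Submonoid.closure_induction with
  | mem g hg =>
    obtain ⟨i, rfl⟩ := hg
    refine ⟨Pi.single i 1, fun x => ?_⟩
    rw [expNegCoord_apply, Finset.sum_eq_single i]
    · simp
    · intro j _ hj
      simp [Pi.single_eq_of_ne hj]
    · simp
  | one => exact ⟨0, fun x => by simp [expNeg_zero]⟩
  | mul g g' _ _ hg hg' =>
    obtain ⟨z, hz⟩ := hg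
    obtain ⟨z', hz'⟩ := hg'
    refine ⟨z + z', fun x => ?_⟩
    rw [BoundedContinuousFunction.mul_apply, hz, hz', ← ENNReal.toReal_mul, ← expNeg_add,
      ← Finset.sum_add_distrib]
    simp [add_mul]

/-- Probability measures on `[0,∞]^κ` are determined by their Laplace transforms. -/
theorem ext_of_lintegral_expNeg {κ : Type*} [Fintype κ] {μ μ' : Measure (κ → ℝ≥0∞)} [IsProbabilityMeasure μ]
    [IsProbabilityMeasure μ']
    (h : ∀ z : κ → ℝ≥0, ∫⁻ x, expNeg (∑ i, z i * x i) ∂μ = ∫⁻ x, expNeg (∑ i, z i * x i) ∂μ') :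
    μ = μ' := by
  -- A point-separating algebra of bounded continuous functions determines the measure. This algebra
  -- is the linear span of products of the `expNegCoord i`, so linearity reduces to Laplace
  -- transforms.
  refine ext_of_forall_mem_subalgebra_integral_eq_of_polish (𝕜 := ℝ) (A := laplaceAlgebra κ) ?_ ?_
  · intro x y hxy
    obtain ⟨i, hi⟩ := Function.ne_iff.1 hxy
    refine ⟨expNegCoord i, ⟨_, ⟨expNegCoord i, ?_, rfl⟩, rfl⟩, ?_⟩
    · exact Algebra.subset_adjoin ⟨i, rfl⟩
    · intro heq
      refine hi (strictAnti_expNeg.injective ?_)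
      exact (ENNReal.toReal_eq_toReal_iff' (expNeg_ne_top _) (expNeg_ne_top _)).1 heq
  · intro g hg
    have hg' : g ∈ Submodule.span ℝ
        (Submonoid.closure (Set.range (expNegCoord (κ := κ))) : Set _) := by
      rw [← Algebra.adjoin_eq_span]
      exact hg
    induction hg' using Submodule.span_induction with
    | mem g hg1 =>
      obtain ⟨z, hz⟩ := exists_eq_of_mem_closure hg1
      have hm : Measurable fun x : κ → ℝ≥0∞ => expNeg (∑ i, z i * x i) := by fun_prop
      have hI : ∀ ρ : Measure (κ → ℝ≥0∞),
          ∫ x, g x ∂ρ = (∫⁻ x, expNeg (∑ i, z i * x i) ∂ρ).toReal := fun ρ => by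
        simp only [hz]
        exact integral_toReal hm.aemeasurable (ae_of_all _ fun x => (expNeg_ne_top _).lt_top)
      rw [hI, hI, h]
    | zero => simp
    | add g g' h1 h2 ih ih' =>
      have e1 := ih (by
        change g ∈ Algebra.adjoin ℝ _
        rw [← Subalgebra.mem_toSubmodule, Algebra.adjoin_eq_span]
        exact h1)
      have e2 := ih' (by
        change g' ∈ Algebra.adjoin ℝ _
        rw [← Subalgebra.mem_toSubmodule, Algebra.adjoin_eq_span]
        exact h2)
      simp only [BoundedContinuousFunction.add_apply]
      rw [integral_add (g.integrable μ) (g'.integrable μ),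
        integral_add (g.integrable μ') (g'.integrable μ'), e1, e2]
    | smul c g h1 ih =>
      have e1 := ih (by
        change g ∈ Algebra.adjoin ℝ _
        rw [← Subalgebra.mem_toSubmodule, Algebra.adjoin_eq_span]
        exact h1)
      simp only [BoundedContinuousFunction.coe_smul, smul_eq_mul]
      rw [integral_const_mul, integral_const_mul, e1]

end Laplace

/-! ### Poisson sums -/

section Poisson

variable {E : Type*} [MeasurableSpace E]

/-- The sum of `f` over the first `N` points of a sequence. -/
def finiteSum {E : Type*} (f : E → ℝ≥0∞) (ω : ℕ × (ℕ → E)) : ℝ≥0∞ := ∑ i ∈ Finset.range ω.1, f (ω.2 i)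

lemma measurable_finiteSum {f : E → ℝ≥0∞} (hf : Measurable f) : Measurable (finiteSum f) :=
  measurable_from_prod_countable_right fun N =>
    Finset.measurable_sum (Finset.range N) fun i _ => hf.comp (measurable_pi_apply i)

/-- Given `N` points the mean is `q ^ N`, where `q` is the mean of `e^{-f}` under `ρ`; for a Poisson
number of points, `E q^N = e^{-r(1 - q)}`. -/
lemma lintegral_expNeg_finiteSum (r : ℝ≥0) (ρ : Measure E) [IsProbabilityMeasure ρ]
    {f : E → ℝ≥0∞} (hf : Measurable f) :
    ∫⁻ ω, expNeg (finiteSum f ω) ∂(poissonMeasure r).prod (Measure.infinitePi fun _ : ℕ => ρ) =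
      expNeg (∫⁻ x, (1 - expNeg (f x)) ∂(r • ρ)) := by
  have hfm : Measurable fun x => expNeg (f x) := measurable_expNeg.comp hf
  have hle : ∫⁻ x, expNeg (f x) ∂ρ ≤ 1 :=
    (lintegral_mono fun x => expNeg_le_one (f x)).trans_eq (by simp)
  obtain ⟨q, hq⟩ : ∃ q : ℝ≥0, ∫⁻ x, expNeg (f x) ∂ρ = q :=
    ⟨_, (ENNReal.coe_toNNReal (hle.trans_lt ENNReal.one_lt_top).ne).symm⟩
  have hq1 : q ≤ 1 := by
    rw [hq] at hle
    exact_mod_cast hle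
  have hind : iIndepFun (fun (i : ℕ) (ξ : ℕ → E) => expNeg (f (ξ i)))
      (Measure.infinitePi fun _ : ℕ => ρ) :=
    iIndepFun_infinitePi (P := fun _ : ℕ => ρ) (X := fun _ x => expNeg (f x)) fun _ => hfm
  have hN : ∀ N : ℕ, ∫⁻ ξ, expNeg (finiteSum f (N, ξ)) ∂(Measure.infinitePi fun _ : ℕ => ρ) =
      (q : ℝ≥0∞) ^ N := by
    intro N
    simp only [finiteSum, expNeg_sum]
    rw [lintegral_prod_eq_prod_lintegral_of_indepFun _ _ hind
      fun i => hfm.comp (measurable_pi_apply i)]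
    have hi : ∀ i : ℕ, ∫⁻ ξ : ℕ → E, expNeg (f (ξ i)) ∂(Measure.infinitePi fun _ : ℕ => ρ) = q := by
      intro i
      rw [← hq, ← (measurePreserving_eval_infinitePi (fun _ : ℕ => ρ) i).lintegral_comp hfm]
    simp [hi]
  have hSm : Measurable fun ω => expNeg (finiteSum f ω) :=
    measurable_expNeg.comp (measurable_finiteSum hf)
  rw [lintegral_prod _ hSm.aemeasurable]
  simp only [hN]
  have h1 : ∫⁻ x, (1 - expNeg (f x)) ∂(r • ρ) = ((r * (1 - q) : ℝ≥0) : ℝ≥0∞) := by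
    rw [lintegral_smul_measure, lintegral_sub hfm (by rw [hq]; exact ENNReal.coe_ne_top)
      (ae_of_all _ fun x => expNeg_le_one _), hq]
    simp [ENNReal.smul_def]
  rw [h1, expNeg_coe, poissonMeasure, lintegral_sum_measure]
  simp only [lintegral_smul_measure, lintegral_dirac, smul_eq_mul]
  have h2 : ∀ N : ℕ, ENNReal.ofReal (Real.exp (-r) * r ^ N / N.factorial) * (q : ℝ≥0∞) ^ N =
      ENNReal.ofReal (Real.exp (-r) * ((r * q : ℝ) ^ N / N.factorial)) := by
    intro N
    rw [← ENNReal.ofReal_coe_nnreal (p := q), ← ENNReal.ofReal_pow q.coe_nonneg,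
      ← ENNReal.ofReal_mul (by positivity)]
    congr 1
    rw [mul_pow]
    ring
  simp only [h2]
  have h3 : HasSum (fun N : ℕ => Real.exp (-r) * ((r * q : ℝ) ^ N / N.factorial))
      (Real.exp (-r) * Real.exp (r * q)) := by
    have := NormedSpace.expSeries_div_hasSum_exp (r * q : ℝ)
    rw [← Real.exp_eq_exp_ℝ] at this
    exact this.mul_left _
  rw [← ENNReal.ofReal_tsum_of_nonneg (fun N => by positivity) h3.summable, h3.tsum_eq,
    ← Real.exp_add]
  congr 2
  rw [NNReal.coe_mul, NNReal.coe_sub hq1]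
  push_cast
  ring

lemma exists_eq_smul_isProbabilityMeasure [Nonempty E] (μ : Measure E) [IsFiniteMeasure μ] :
    ∃ (r : ℝ≥0) (ρ : Measure E), IsProbabilityMeasure ρ ∧ μ = r • ρ := by
  let μ' : FiniteMeasure E := ⟨μ, inferInstance⟩
  refine ⟨μ'.mass, μ'.normalize, inferInstance, ?_⟩
  have := congrArg (fun m : FiniteMeasure E => (m : Measure E)) μ'.self_eq_mass_smul_normalize
  simpa [μ'] using this

/-- The sum of `f` over the points of countably many finite collections. -/
def poissonSum {E : Type*} (f : E → ℝ≥0∞) (ω : ℕ → ℕ × (ℕ → E)) : ℝ≥0∞ := ∑' j, finiteSum f (ω j)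

lemma measurable_poissonSum {f : E → ℝ≥0∞} (hf : Measurable f) : Measurable (poissonSum f) :=
  Measurable.tsum fun j => (measurable_finiteSum hf).comp (measurable_pi_apply j)

lemma poissonSum_zero {E : Type*} (ω : ℕ → ℕ × (ℕ → E)) : poissonSum (fun _ => 0) ω = 0 := by
  simp [poissonSum, finiteSum]

lemma poissonSum_sum {E κ : Type*} (s : Finset κ) (f : κ → E → ℝ≥0∞) (ω : ℕ → ℕ × (ℕ → E)) :
    poissonSum (fun x => ∑ k ∈ s, f k x) ω = ∑ k ∈ s, poissonSum (f k) ω := by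
  simp only [poissonSum, finiteSum]
  rw [← Summable.tsum_finsetSum fun _ _ => ENNReal.summable]
  exact tsum_congr fun j => Finset.sum_comm

lemma poissonSum_const_mul {E : Type*} (c : ℝ≥0∞) (f : E → ℝ≥0∞) (ω : ℕ → ℕ × (ℕ → E)) :
    poissonSum (fun x => c * f x) ω = c * poissonSum f ω := by
  simp only [poissonSum, finiteSum, ← Finset.mul_sum, ENNReal.tsum_mul_left]

/-- The Laplace functional of a Poisson random measure of intensity `μ`. -/
theorem exists_lintegral_expNeg_poissonSum [Nonempty E] (μ : Measure E) [SFinite μ] :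
    ∃ P : Measure (ℕ → ℕ × (ℕ → E)), IsProbabilityMeasure P ∧ ∀ f : E → ℝ≥0∞, Measurable f →
      ∫⁻ ω, expNeg (poissonSum f ω) ∂P = expNeg (∫⁻ x, (1 - expNeg (f x)) ∂μ) := by
  -- An s-finite intensity is a countable sum of finite ones. Independent Poisson collections for
  -- the pieces are superposed, so Laplace functionals multiply, and the limit over partial sums is
  -- taken by dominated convergence.
  choose r ρ hρ hμ using fun j => exists_eq_smul_isProbabilityMeasure (sfiniteSeq μ j)
  set P : ℕ → Measure (ℕ × (ℕ → E)) := fun j =>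
    (poissonMeasure (r j)).prod (Measure.infinitePi fun _ : ℕ => ρ j) with hP
  have hPp : ∀ j, IsProbabilityMeasure (P j) := fun j => inferInstance
  refine ⟨Measure.infinitePi P, inferInstance, fun f hf => ?_⟩
  have hfm : Measurable fun x : ℕ × (ℕ → E) => expNeg (finiteSum f x) :=
    measurable_expNeg.comp (measurable_finiteSum hf)
  have hind : iIndepFun (fun (j : ℕ) (ω : ℕ → ℕ × (ℕ → E)) => expNeg (finiteSum f (ω j)))
      (Measure.infinitePi P) :=
    iIndepFun_infinitePi (P := P) (X := fun _ x => expNeg (finiteSum f x)) fun _ => hfm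
  have hJ : ∀ J : ℕ, ∫⁻ ω, expNeg (∑ j ∈ Finset.range J, finiteSum f (ω j))
      ∂(Measure.infinitePi P) =
      expNeg (∑ j ∈ Finset.range J, ∫⁻ x, (1 - expNeg (f x)) ∂(sfiniteSeq μ j)) := by
    intro J
    simp only [expNeg_sum]
    rw [lintegral_prod_eq_prod_lintegral_of_indepFun _ _ hind
      fun j => hfm.comp (measurable_pi_apply j)]
    refine Finset.prod_congr rfl fun j _ => ?_
    rw [hμ j, ← lintegral_expNeg_finiteSum (r j) (ρ j) hf,
      ← (measurePreserving_eval_infinitePi P j).lintegral_comp hfm]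
  have hlim1 : Tendsto (fun J : ℕ => ∫⁻ ω, expNeg (∑ j ∈ Finset.range J, finiteSum f (ω j))
      ∂(Measure.infinitePi P)) atTop (𝓝 (∫⁻ ω, expNeg (poissonSum f ω) ∂(Measure.infinitePi P))) := by
    refine tendsto_lintegral_of_dominated_convergence (fun _ => 1) (fun J => ?_)
      (fun J => ae_of_all _ fun ω => expNeg_le_one _) (by simp) (ae_of_all _ fun ω => ?_)
    · exact measurable_expNeg.comp (Finset.measurable_sum _ fun j _ =>
        (measurable_finiteSum hf).comp (measurable_pi_apply j))
    · exact (continuous_expNeg.tendsto _).comp ENNReal.summable.hasSum.tendsto_sum_nat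
  have hlim2 : Tendsto (fun J : ℕ =>
      expNeg (∑ j ∈ Finset.range J, ∫⁻ x, (1 - expNeg (f x)) ∂(sfiniteSeq μ j))) atTop
      (𝓝 (expNeg (∫⁻ x, (1 - expNeg (f x)) ∂μ))) := by
    refine (continuous_expNeg.tendsto _).comp ?_
    conv => enter [3, 1]; rw [← sum_sfiniteSeq μ, lintegral_sum_measure]
    exact ENNReal.summable.hasSum.tendsto_sum_nat
  simp only [hJ] at hlim1
  exact tendsto_nhds_unique hlim1 hlim2

end Poisson

/-! ### The jump measure of a function of the class -/

/-- The jump measure on `[0,∞]` with the jumps `ν` on `(0,∞)` and the rate `c` of a jump to `∞`. -/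
def jumpMeasure (c : ℝ≥0) (ν : Measure ℝ) : Measure ℝ≥0∞ :=
  (ν.restrict (Set.Ioi 0)).map ENNReal.ofReal + c • Measure.dirac ∞

/-- Weighting by `min(r, 1)` makes the measure finite, and dividing by this positive density
recovers it. -/
lemma sFinite_restrict_Ioi {ν : Measure ℝ}
    (hν : ∫⁻ r in Set.Ioi (0 : ℝ), ENNReal.ofReal (min r 1) ∂ν < ∞) :
    SFinite (ν.restrict (Set.Ioi 0)) := by
  have hf : Measurable fun r : ℝ => ENNReal.ofReal (min r 1) := by fun_prop
  have h1 : IsFiniteMeasure ((ν.restrict (Set.Ioi 0)).withDensity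
      fun r : ℝ => ENNReal.ofReal (min r 1)) := isFiniteMeasure_withDensity hν.ne
  have h2 := withDensity_inv_same (μ := ν.restrict (Set.Ioi 0)) hf
    ((ae_restrict_mem measurableSet_Ioi).mono fun r hr => by
      have : (0 : ℝ) < r := hr
      simp [this])
    (ae_of_all _ fun r => ENNReal.ofReal_ne_top)
  rw [← h2]
  infer_instance

lemma sFinite_jumpMeasure (c : ℝ≥0) {ν : Measure ℝ}
    (hν : ∫⁻ r in Set.Ioi (0 : ℝ), ENNReal.ofReal (min r 1) ∂ν < ∞) :
    SFinite (jumpMeasure c ν) := by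
  have := sFinite_restrict_Ioi hν
  unfold jumpMeasure
  infer_instance

lemma one_sub_exp_le_mul_min {r z : ℝ} (hr : 0 < r) (hz : 0 ≤ z) :
    1 - Real.exp (-(r * z)) ≤ (1 + z) * min r 1 := by
  have h1 : 1 - r * z ≤ Real.exp (-(r * z)) := by
    have := Real.add_one_le_exp (-(r * z))
    linarith
  have h2 := (Real.exp_pos (-(r * z))).le
  rcases le_total r 1 with h | h
  · rw [min_eq_left h]
    nlinarith
  · rw [min_eq_right h]
    linarith

/-- The atom at `∞` produces the term `c 𝟙{z > 0}`, because `1 - e^{-z∞}` is `1` for `z > 0` and `0`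
for `z = 0`. -/
lemma lintegral_jumpMeasure (c : ℝ≥0) {ν : Measure ℝ}
    (hν : ∫⁻ r in Set.Ioi (0 : ℝ), ENNReal.ofReal (min r 1) ∂ν < ∞) (z : ℝ≥0) :
    ∫⁻ r, (1 - expNeg (z * r)) ∂jumpMeasure c ν =
      ENNReal.ofReal (c * (if 0 < z then 1 else 0)
        + ∫ r in Set.Ioi (0 : ℝ), (1 - Real.exp (-(r * z))) ∂ν) := by
  have hm : Measurable fun r : ℝ≥0∞ => 1 - expNeg (z * r) := by fun_prop
  have hnn : ∀ r ∈ Set.Ioi (0 : ℝ), 0 ≤ 1 - Real.exp (-(r * z)) := by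
    intro r hr
    have : (0 : ℝ) ≤ r * z := mul_nonneg (le_of_lt hr) z.coe_nonneg
    simpa using this
  have hint : Integrable (fun r : ℝ => 1 - Real.exp (-(r * z))) (ν.restrict (Set.Ioi 0)) := by
    have h1 : Integrable (fun r : ℝ => min r 1) (ν.restrict (Set.Ioi 0)) := by
      refine ⟨by fun_prop, ?_⟩
      rw [hasFiniteIntegral_iff_ofReal]
      · exact hν
      · exact (ae_restrict_mem measurableSet_Ioi).mono fun r hr =>
          le_min (le_of_lt hr) zero_le_one
    refine (h1.const_mul (1 + z)).mono' (by fun_prop) ?_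
    refine (ae_restrict_mem measurableSet_Ioi).mono fun r hr => ?_
    rw [Real.norm_of_nonneg (hnn r hr)]
    exact one_sub_exp_le_mul_min hr z.coe_nonneg
  have hI : 0 ≤ ∫ r in Set.Ioi (0 : ℝ), (1 - Real.exp (-(r * z))) ∂ν :=
    setIntegral_nonneg measurableSet_Ioi hnn
  rw [jumpMeasure, lintegral_add_measure, lintegral_map hm ENNReal.measurable_ofReal,
    lintegral_smul_measure, lintegral_dirac, add_comm, ENNReal.ofReal_add (by positivity) hI]
  congr 1
  · split_ifs with hz
    · simp [ENNReal.mul_top, hz.ne', expNeg_top, ENNReal.smul_def]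
    · have : z = 0 := by simpa using hz
      simp [this, expNeg_zero]
  · rw [ofReal_integral_eq_lintegral_ofReal hint ((ae_restrict_mem measurableSet_Ioi).mono hnn)]
    refine setLIntegral_congr_fun measurableSet_Ioi fun r hr => ?_
    have hr' : (0 : ℝ) ≤ r := le_of_lt hr
    rw [← ENNReal.ofReal_coe_nnreal (p := z), ← ENNReal.ofReal_mul z.coe_nonneg,
      expNeg_ofReal (by positivity), ENNReal.ofReal_sub _ (Real.exp_pos _).le, ENNReal.ofReal_one,
      mul_comm r]

/-! ### The process -/

/-- The contribution of a jump of size `p.1` at time `p.2` to the increment over `(a, b]`. -/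
def jump (a b : ℝ≥0) (p : ℝ≥0∞ × ℝ) : ℝ≥0∞ :=
  (Set.Ioc (a : ℝ) b).indicator (fun _ => p.1) p.2

lemma measurable_jump (a b : ℝ≥0) : Measurable (jump a b) := by
  have : jump a b = (Prod.snd ⁻¹' Set.Ioc (a : ℝ) b).indicator Prod.fst := by
    ext p
    simp [jump, Set.indicator]
  rw [this]
  exact measurable_fst.indicator (measurable_snd measurableSet_Ioc)

/-- The increment over `(a, b]` of the process with drift `γ` and given jumps. -/
def increment (γ a b : ℝ≥0) (ω : ℕ → ℕ × (ℕ → ℝ≥0∞ × ℝ)) : ℝ≥0∞ :=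
  γ * (b - a : ℝ≥0) + poissonSum (jump a b) ω

lemma measurable_increment (γ a b : ℝ≥0) : Measurable (increment γ a b) :=
  measurable_const.add (measurable_poissonSum (measurable_jump a b))

lemma jump_add {a b b' : ℝ≥0} (h : a ≤ b) (h' : b ≤ b') (p : ℝ≥0∞ × ℝ) :
    jump a b p + jump b b' p = jump a b' p := by
  have hu : Set.Ioc (a : ℝ) b ∪ Set.Ioc (b : ℝ) b' = Set.Ioc (a : ℝ) b' :=
    Set.Ioc_union_Ioc_eq_Ioc (by exact_mod_cast h) (by exact_mod_cast h')
  rw [jump, jump, jump, ← hu, Set.indicator_union_of_disjoint]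
  rw [Set.disjoint_left]
  exact fun x hx hx' => absurd hx.2 (not_le.2 hx'.1)

/-- Increments are read off from the jumps and not as differences of values, so additivity survives
infinite values. -/
lemma increment_add (γ : ℝ≥0) {a b b' : ℝ≥0} (h : a ≤ b) (h' : b ≤ b')
    (ω : ℕ → ℕ × (ℕ → ℝ≥0∞ × ℝ)) :
    increment γ a b ω + increment γ b b' ω = increment γ a b' ω := by
  have h1 : poissonSum (jump a b') ω = poissonSum (jump a b) ω + poissonSum (jump b b') ω := by
    have : jump a b' = fun p => ∑ k : Bool, (bif k then jump a b p else jump b b' p) := by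
      ext p
      rw [← jump_add h h' p]
      simp
    rw [this, poissonSum_sum Finset.univ (fun k p => bif k then jump a b p else jump b b' p)]
    simp
  have h2 : (b' - a : ℝ≥0) = (b - a) + (b' - b) := by
    rw [add_comm, tsub_add_tsub_cancel h' h]
  rw [increment, increment, increment, h1, h2, ENNReal.coe_add, mul_add]
  ring

lemma increment_self (γ a : ℝ≥0) (ω : ℕ → ℕ × (ℕ → ℝ≥0∞ × ℝ)) : increment γ a a ω = 0 := by
  have : jump a a = fun _ => 0 := by
    ext p
    simp [jump]
  rw [increment, this, poissonSum_zero]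
  simp

lemma sum_increment (γ : ℝ≥0) {T : ℕ → ℝ≥0} (hT : Monotone T) (m : ℕ)
    (ω : ℕ → ℕ × (ℕ → ℝ≥0∞ × ℝ)) :
    ∑ j ∈ Finset.range m, increment γ (T j) (T (j + 1)) ω = increment γ (T 0) (T m) ω := by
  induction m with
  | zero => simp [increment_self]
  | succ m ih =>
    rw [Finset.sum_range_succ, ih, increment_add γ (hT (Nat.zero_le m)) (hT (Nat.le_succ m))]

/-- At most one summand is nonzero, so the nonlinear function acts additively. This is the source of
independence over disjoint time intervals. -/
lemma one_sub_expNeg_sum {κ : Type*} (s : Finset κ) (x : κ → ℝ≥0∞)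
    (h : ∀ k ∈ s, ∀ l ∈ s, k ≠ l → x k = 0 ∨ x l = 0) :
    1 - expNeg (∑ k ∈ s, x k) = ∑ k ∈ s, (1 - expNeg (x k)) := by
  by_cases h0 : ∀ k ∈ s, x k = 0
  · rw [Finset.sum_eq_zero h0, Finset.sum_eq_zero fun k hk => by simp [h0 k hk, expNeg_zero]]
    simp [expNeg_zero]
  · push Not at h0
    obtain ⟨k, hk, hk0⟩ := h0
    have h1 : ∀ l ∈ s, l ≠ k → x l = 0 := fun l hl hlk =>
      (h l hl k hk hlk).resolve_right hk0
    rw [Finset.sum_eq_single_of_mem k hk h1, Finset.sum_eq_single_of_mem k hk fun l hl hlk => by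
      simp [h1 l hl hlk, expNeg_zero]]

lemma lintegral_one_sub_expNeg_jump (ν : Measure ℝ≥0∞) [SFinite ν] (z a b : ℝ≥0) :
    ∫⁻ p, (1 - expNeg (z * jump a b p)) ∂ν.prod (volume : Measure ℝ) =
      (b - a : ℝ≥0) * ∫⁻ r, (1 - expNeg (z * r)) ∂ν := by
  have h1 : ∀ p : ℝ≥0∞ × ℝ, 1 - expNeg (z * jump a b p) =
      (1 - expNeg (z * p.1)) * (Set.Ioc (a : ℝ) b).indicator 1 p.2 := by
    intro p
    by_cases hp : p.2 ∈ Set.Ioc (a : ℝ) b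
    · rw [jump, Set.indicator_of_mem hp, Set.indicator_of_mem hp]
      simp
    · rw [jump, Set.indicator_of_notMem hp, Set.indicator_of_notMem hp]
      simp [expNeg_zero]
  simp only [h1]
  rw [lintegral_prod_mul (f := fun r => 1 - expNeg (z * r)) (by fun_prop)
    (measurable_one.indicator measurableSet_Ioc).aemeasurable,
    lintegral_indicator_one measurableSet_Ioc, Real.volume_Ioc, mul_comm]
  rw [ENNReal.ofReal]
  congr 1

/-- The joint Laplace transform of increments over disjoint intervals. -/
lemma lintegral_expNeg_sum_increment {P : Measure (ℕ → ℕ × (ℕ → ℝ≥0∞ × ℝ))} {ν : Measure ℝ≥0∞}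
    [SFinite ν] (hP : ∀ f : ℝ≥0∞ × ℝ → ℝ≥0∞, Measurable f →
      ∫⁻ ω, expNeg (poissonSum f ω) ∂P =
        expNeg (∫⁻ x, (1 - expNeg (f x)) ∂ν.prod (volume : Measure ℝ)))
    (γ : ℝ≥0) {G : ℝ≥0 → ℝ≥0} (hG : ∀ z : ℝ≥0, (G z : ℝ≥0∞) = γ * z + ∫⁻ r, (1 - expNeg (z * r)) ∂ν)
    {κ : Type*} [Fintype κ] {a b : κ → ℝ≥0}
    (hdisj : Pairwise fun k l => Disjoint (Set.Ioc (a k : ℝ) (b k)) (Set.Ioc (a l : ℝ) (b l)))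
    (z : κ → ℝ≥0) :
    ∫⁻ ω, expNeg (∑ k, z k * increment γ (a k) (b k) ω) ∂P =
      ∏ k, expNeg ((b k - a k : ℝ≥0) * G (z k)) := by
  have h1 : ∀ ω, ∑ k, z k * increment γ (a k) (b k) ω =
      (∑ k, (z k : ℝ≥0∞) * (γ * (b k - a k : ℝ≥0))) +
        poissonSum (fun p => ∑ k, z k * jump (a k) (b k) p) ω := by
    intro ω
    rw [poissonSum_sum Finset.univ (fun k p => z k * jump (a k) (b k) p), ← Finset.sum_add_distrib]
    simp only [poissonSum_const_mul, increment, mul_add]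
  have hm : ∀ k, Measurable fun p => (z k : ℝ≥0∞) * jump (a k) (b k) p := fun k =>
    (measurable_jump _ _).const_mul _
  have hms : Measurable fun p => ∑ k, (z k : ℝ≥0∞) * jump (a k) (b k) p :=
    Finset.measurable_sum _ fun k _ => hm k
  simp only [h1, expNeg_add]
  have hpm : Measurable fun ω => expNeg (poissonSum (fun p => ∑ k, z k * jump (a k) (b k) p) ω) :=
    measurable_expNeg.comp (measurable_poissonSum hms)
  rw [lintegral_const_mul _ hpm, hP _ hms]
  have h2 : ∀ p, 1 - expNeg (∑ k, (z k : ℝ≥0∞) * jump (a k) (b k) p) =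
      ∑ k, (1 - expNeg (z k * jump (a k) (b k) p)) := by
    intro p
    refine one_sub_expNeg_sum _ _ fun k _ l _ hkl => ?_
    by_cases hk : p.2 ∈ Set.Ioc (a k : ℝ) (b k)
    · right
      rw [jump, Set.indicator_of_notMem (Set.disjoint_left.1 (hdisj hkl) hk), mul_zero]
    · left
      rw [jump, Set.indicator_of_notMem hk, mul_zero]
  have hm' : ∀ k, Measurable fun p => 1 - expNeg (z k * jump (a k) (b k) p) := fun k =>
    measurable_const.sub (measurable_expNeg.comp (hm k))
  simp only [h2]
  rw [lintegral_finsetSum _ fun k _ => hm' k,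
    ← expNeg_add, ← Finset.sum_add_distrib, expNeg_sum]
  refine Finset.prod_congr rfl fun k _ => ?_
  rw [lintegral_one_sub_expNeg_jump, hG, mul_add]
  congr 2
  ring

/-- Every function of the class has a corresponding non-negative Lévy process. -/
theorem exists_isLevyOf {G : ℝ≥0 → ℝ≥0} (hG : G ∈ classG) :
    ∃ (Ω : Type) (_ : MeasurableSpace Ω) (P : Measure Ω) (X : ℝ≥0 → Ω → ℝ≥0∞), IsLevyOf G P X := by
  obtain ⟨c, γ, ν, hν, hGz⟩ := hG
  have hsf := sFinite_jumpMeasure c hν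
  have hG' : ∀ z : ℝ≥0, (G z : ℝ≥0∞) = γ * z + ∫⁻ r, (1 - expNeg (z * r)) ∂jumpMeasure c ν := by
    intro z
    have hI : 0 ≤ ∫ r in Set.Ioi (0 : ℝ), (1 - Real.exp (-(r * z))) ∂ν :=
      setIntegral_nonneg measurableSet_Ioi fun r hr => by
        have : (0 : ℝ) ≤ r * z := mul_nonneg (le_of_lt hr) z.coe_nonneg
        simpa using this
    rw [lintegral_jumpMeasure c hν, ← ENNReal.coe_mul, ← ENNReal.ofReal_coe_nnreal,
      ← ENNReal.ofReal_coe_nnreal, hGz, ← ENNReal.ofReal_add (by positivity) (by positivity)]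
    congr 1
    push_cast
    ring
  obtain ⟨P, hPp, hP⟩ := exists_lintegral_expNeg_poissonSum
    ((jumpMeasure c ν).prod (volume : Measure ℝ))
  have hjoint := fun (κ : Type) [Fintype κ] (a b : κ → ℝ≥0) h z =>
    lintegral_expNeg_sum_increment hP γ hG' (κ := κ) (a := a) (b := b) h z
  have hlap : ∀ t z : ℝ≥0, ∫⁻ ω, expNeg (z * increment γ 0 t ω) ∂P = expNeg (t * G z) := by
    intro t z
    have := hjoint Unit (fun _ => 0) (fun _ => t) (fun k l hkl => absurd (Subsingleton.elim k l) hkl)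
      fun _ => z
    simpa using this
  refine ⟨_, _, P, fun t => increment γ 0 t, ⟨hPp, fun t => measurable_increment γ 0 t, ?_,
    ae_of_all _ fun ω => increment_self γ 0 ω, ?_⟩, ?_⟩
  · intro k s
    -- Durations are continued by zero so that the partial sums `T` form a monotone sequence indexed
    -- by all naturals.
    set s' : ℕ → ℝ≥0 := fun j => if h : j < k then s ⟨j, h⟩ else 0 with hs'
    set T : ℕ → ℝ≥0 := fun m => ∑ j ∈ Finset.range m, s' j with hTdef
    have hTmono : Monotone T := fun m m' h => Finset.sum_le_sum_of_subset (Finset.range_mono h)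
    have hTsub : ∀ j : Fin k, T (j + 1) - T j = s j := by
      intro j
      rw [hTdef]
      simp only [Finset.sum_range_succ, add_tsub_cancel_left]
      simp [hs']
    have hIic : ∀ (M : Type) [AddCommMonoid M] (F : ℕ → M) (i : Fin k),
        ∑ j ∈ Finset.Iic i, F j = ∑ j ∈ Finset.range (i + 1), F j := by
      intro M _ F i
      rw [Nat.range_succ_eq_Iic, ← Fin.map_valEmbedding_Iic, Finset.sum_map]
      rfl
    have hTi : ∀ i : Fin k, ∑ j ∈ Finset.Iic i, s j = T (i + 1) := by
      intro i
      rw [hTdef]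
      simp only
      rw [← hIic]
      exact Finset.sum_congr rfl fun j _ => by simp [hs']
    have hDm : Measurable fun ω (j : Fin k) => increment γ (T j) (T (j + 1)) ω :=
      measurable_pi_lambda _ fun j => measurable_increment _ _ _
    have hSm : Measurable fun (d : Fin k → ℝ≥0∞) (i : Fin k) => ∑ j ∈ Finset.Iic i, d j := by
      fun_prop
    have hXp : ∀ i, IsProbabilityMeasure (P.map (increment γ 0 (s i))) := fun i =>
      Measure.isProbabilityMeasure_map (measurable_increment _ _ _).aemeasurable
    -- Independence and stationarity at once: the increments over the successive intervals of `T`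
    -- and the product of the laws of `X (s i)` have the same joint Laplace transform.
    have hlaw : P.map (fun ω (j : Fin k) => increment γ (T j) (T (j + 1)) ω) =
        Measure.pi fun i => P.map (increment γ 0 (s i)) := by
      have hp := Measure.isProbabilityMeasure_map hDm.aemeasurable (μ := P)
      refine ext_of_lintegral_expNeg fun z => ?_
      have hzm : Measurable fun x : Fin k → ℝ≥0∞ => expNeg (∑ i, z i * x i) := by fun_prop
      rw [lintegral_map hzm hDm, hjoint (Fin k) (fun j => T j) (fun j => T (j + 1))]
      · have hfm : ∀ i, Measurable fun d : ℝ≥0∞ => expNeg (z i * d) := fun i => by fun_prop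
        have hind := iIndepFun_pi (μ := fun i => P.map (increment γ 0 (s i)))
          (X := fun i d => expNeg (z i * d)) fun i => (hfm i).aemeasurable
        simp only [expNeg_sum]
        rw [lintegral_prod_eq_prod_lintegral_of_indepFun _ _ hind
          fun i => (hfm i).comp (measurable_pi_apply i)]
        refine Finset.prod_congr rfl fun i _ => ?_
        rw [hTsub, (measurePreserving_eval (fun i => P.map (increment γ 0 (s i))) i).lintegral_comp
          (hfm i), lintegral_map (hfm i) (measurable_increment _ _ _), hlap]
      · intro i j hij
        have hT' : Monotone fun m => (T m : ℝ) := fun m m' h => NNReal.coe_le_coe.2 (hTmono h)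
        exact hT'.pairwise_disjoint_on_Ioc_succ (Fin.val_injective.ne hij)
    rw [← hlaw, Measure.map_map hSm hDm]
    congr 1
    funext ω i
    simp only [Function.comp]
    rw [hTi, hIic ℝ≥0∞ (fun j => increment γ (T j) (T (j + 1)) ω), sum_increment γ hTmono]
    simp [hTdef]
  · intro ε hε
    have hδ : 1 - expNeg ε ≠ 0 := by
      have : expNeg ε < 1 := by
        rw [← expNeg_zero]
        exact strictAnti_expNeg (by exact_mod_cast hε)
      exact (tsub_pos_of_lt this).ne'
    -- Markov's inequality is applied to `1 - e^{-X_t}`, since `X_t` itself may have infinite mean.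
    have hbound : ∀ t : ℝ≥0, P {ω | (ε : ℝ≥0∞) < increment γ 0 t ω} ≤
        (1 - expNeg (t * G 1)) / (1 - expNeg ε) := by
      intro t
      have hm : Measurable fun ω => expNeg (increment γ 0 t ω) :=
        measurable_expNeg.comp (measurable_increment _ _ _)
      have h1 : ∫⁻ ω, (1 - expNeg (increment γ 0 t ω)) ∂P = 1 - expNeg (t * G 1) := by
        have h2 := hlap t 1
        simp only [ENNReal.coe_one, one_mul] at h2
        rw [lintegral_sub hm (by rw [h2]; exact expNeg_ne_top _)
          (ae_of_all _ fun ω => expNeg_le_one _), h2]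
        simp
      rw [ENNReal.le_div_iff_mul_le (Or.inl hδ) (Or.inl (by finiteness)), mul_comm, ← h1]
      refine le_trans ?_ (mul_meas_ge_le_lintegral (measurable_const.sub hm) (1 - expNeg ε))
      gcongr
      exact fun hω => tsub_le_tsub_left (strictAnti_expNeg hω).le 1
    refine tendsto_of_tendsto_of_tendsto_of_le_of_le tendsto_const_nhds ?_
      (fun _ => zero_le) hbound
    have hc : Tendsto (fun t : ℝ≥0 => expNeg (t * G 1)) (𝓝[>] 0) (𝓝 1) := by
      have h1 : Continuous fun t : ℝ≥0 => expNeg ((t * G 1 : ℝ≥0) : ℝ≥0∞) :=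
        continuous_expNeg.comp (ENNReal.continuous_coe.comp (by fun_prop))
      have h2 := (h1.tendsto 0).mono_left (nhdsWithin_le_nhds (s := Set.Ioi 0))
      simpa [expNeg_zero] using h2
    have h3 := ENNReal.Tendsto.div_const (b := 1 - expNeg ε)
      (ENNReal.Tendsto.sub (tendsto_const_nhds (x := (1 : ℝ≥0∞))) hc (Or.inl ENNReal.one_ne_top))
      (Or.inr hδ)
    simpa using h3
  · intro t z
    have h1 := hlap t z
    rw [← ENNReal.coe_mul, expNeg_coe, NNReal.coe_mul] at h1
    exact h1

end ParetoSampling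

end

theorem mainTheorem3 :
    -- the maximum space over a stream of `poly(n)` updates
    (∀ A k d : ℕ, ∃ C : ℝ, ∀ (n : ℕ) (v : ℕ → Fin n) (Δ : ℕ → ℝ≥0), (∀ i, 0 < Δ i) →
      ∀ (Ω : Type*) [MeasurableSpace Ω] (P : Measure Ω) (Y : ℕ → Ω → ℝ) (H : Fin n → Ω → ℝ),
        ParetoSampling.IsRandomness P Y H →
      ∀ m : ℕ, m ≤ A * n ^ k →
        P {ω | ∃ t ≤ m, C * Real.log n <
            (ParetoSampling.words
              (ParetoSampling.state v Δ (fun i => Y i ω) (fun u => H u ω) t) : ℝ)}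
          ≤ ENNReal.ofReal (1 / (n : ℝ) ^ d)) ∧
    -- every `G` of the class has a corresponding Lévy process, hence a level function
    (∀ G ∈ ParetoSampling.classG,
      ∃ (Ω : Type) (_ : MeasurableSpace Ω) (P : Measure Ω) (X : ℝ≥0 → Ω → ℝ≥0∞),
        ParetoSampling.IsLevyOf G P X) ∧
    (∀ (n : ℕ) (v : ℕ → Fin n) (Δ : ℕ → ℝ≥0), (∀ i, 0 < Δ i) →
      ∀ (Ω : Type*) [MeasurableSpace Ω] (P : Measure Ω) (Y : ℕ → Ω → ℝ) (H : Fin n → Ω → ℝ),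
        ParetoSampling.IsRandomness P Y H →
      ∀ t : ℕ,
        -- the expected size of the frontier at time `t`
        (Integrable (fun ω =>
            ((ParetoSampling.state v Δ (fun i => Y i ω) (fun u => H u ω) t).card : ℝ)) P ∧
          ∫ ω, ((ParetoSampling.state v Δ (fun i => Y i ω) (fun u => H u ω) t).card : ℝ) ∂P =
            ((harmonic (Finset.univ.filter
              fun u => 0 < ParetoSampling.vec v Δ t u).card : ℚ) : ℝ)) ∧
        -- the law of the sample at time `t`, for every `G` and every Lévy process of `G`
        (∀ G ∈ ParetoSampling.classG, 0 < ParetoSampling.moment G (ParetoSampling.vec v Δ t) →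
          ∀ (Ω' : Type*) [MeasurableSpace Ω'] (Q : Measure Ω') (X : ℝ≥0 → Ω' → ℝ≥0∞),
            ParetoSampling.IsLevyOf G Q X →
          ∀ u : Fin n,
            P {ω | ParetoSampling.sample (ParetoSampling.levelFunction Q X)
                (ParetoSampling.state v Δ (fun i => Y i ω) (fun u => H u ω) t) = some u} =
              ((G (ParetoSampling.vec v Δ t u)
                / ParetoSampling.moment G (ParetoSampling.vec v Δ t) : ℝ≥0) : ℝ≥0∞))) := by
  refine ⟨fun A k d => ⟨3 * (k + A + 2 + d : ℕ) / Real.log 2, ?_⟩, fun G hG =>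
    ParetoSampling.exists_isLevyOf hG, ?_⟩
  · intro n v Δ hΔ Ω _ P Y H hR m hm
    exact hR.measure_exists_words_gt hΔ v hm
  · intro n v Δ hΔ Ω _ P Y H hR t
    refine ⟨hR.integral_card_state hΔ v t, ?_⟩
    intro G hG hpos Ω' _ Q X hX u
    exact hR.measure_sample_eq hΔ v t (ParetoSampling.map_zero_of_mem_classG hG) hpos hX u
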